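/- **Setting.** Let $M=(E,\mathcal I)$ be a matroid on a finite ground set $E$ with polytope $\mathcal P_M=\{\mathbf x\in\mathbb R^E:\mathbf x\ge 0,\ \mathbf x(S)\le \operatorname{rank}(S)\ \forall S\subseteq E\}$. A probability distribution $\mathcal D$ over subsets of $E$ is *PI-consistent* with $\mathbf x$ if $\Pr_{R\sim\mathcal D}[i\in R]=x_i$ for all $i$ and $\Pr_{R\sim\mathcal D}[\{i,j\}\subseteq R]=x_ix_j$ for all $i\neq j$. A *greedy PI-OCRS* for $M$ is given $\mathcal D$ and, before the elements arrive, draws (independently of $R$) a random non-empty down-closed family $\mathcal F\subseteq\mathcal I$; it then accepts an arriving active element $e$ iff $I\cup\{e\}\in\mathcal F$, where $I$ is the set accepted so far. It is *$c$-selectable* if for every $\mathbf x\in\mathcal P_M$, every $\mathcal D$ PI-consistent with $\mathbf x$ and every $i\in E$ with $x_i>0$, $$\Pr\big[\,I\cup\{i\}\in\mathcal F\ \text{ for all } I\in\mathcal F \text{ with } I\subseteq R\ \big|\ i\in R\,\big]\ \ge\ c ,$$ the probability being over $R\sim\mathcal D$ and $\mathcal F$. We say that $M$ has a *$c$-approximate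 prophet inequality against the almighty adversary* if for all pairwise-independent random weights $W_i\ge 0$ ($i\in E$) with known joint distribution there is a randomized online algorithm which sees the elements and their weights one by one, irrevocably selects or rejects each, always selects an independent set, and has expected selected weight at least $c\cdot\mathbb E[\max_{I\in\mathcal I}\sum_{i\in I}W_i]$, even if the arrival order is chosen by an adversary who knows all realized weights and all random coins of the algorithm. **Theorem.** Let $M$ be a matroid on a finite ground set. 1. If $M$ is laminar, it has a $\frac1{134}$-selectable PI-OCRS and a $\frac1{134}$-approximate prophet inequality against the almighty adversary. 2. If $M$ is graphic (the matroid of forests of a finite multigraph), it has a $\frac18$-selectable PI-OCRS and a $\frac18$-approximate prophet inequality against the almighty adversary. 3. If $M$ is transversal, it has a $\frac14$-selectable PI-OCRS and a $\frac14$-approximate prophet inequality against the almighty adversary. Here $M$ is *laminar* if there are a family $\mathcal A$ of subsets of $E$, any two nested or disjoint, and capacities $c(A)\in\mathbb N$ such that $I\in\mathcal I$ iff $|I\cap A|\le c(A)$ for all $A\in\mathcal A$; it is *transversal* if there is a finite bipartite graph with sides $E$ and $V$ such that $I\in\mathcal I$ iff $I$ can be matched into $V$. -/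

import Mathlib

open scoped ENNReal NNReal

namespace PIProphet

/-! ### The three classes of matroids -/

/-- `M` is a laminar matroid: there are a laminar family `A` of sets (any two members are nested or
disjoint) and capacities `c` such that a set is independent iff it has at most `c S` elements in
each member `S` of the family. -/
def IsLaminar {E : Type*} (M : Matroid E) : Prop :=
  ∃ (A : Set (Set E)) (c : Set E → ℕ),
    (∀ S ∈ A, ∀ T ∈ A, S ⊆ T ∨ T ⊆ S ∨ Disjoint S T) ∧
    ∀ I : Set E, M.Indep I ↔ I ⊆ M.E ∧ ∀ S ∈ A, (I ∩ S).ncard ≤ c S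

/-- The edge set `C` contains a cycle of the multigraph `G`: distinct vertices `v 0, …, v n` and
distinct edges `e 0, …, e n` of `C`, where `e i` joins `v i` to `v (i + 1)` and indices are
cyclic. A loop is a cycle with `n = 0`, two parallel edges form a cycle with `n = 1`. -/
def ContainsCycle {V E : Type*} (G : Graph V E) (C : Set E) : Prop :=
  ∃ (n : ℕ) (v : Fin (n + 1) → V) (e : Fin (n + 1) → E),
    Function.Injective v ∧ Function.Injective e ∧ (∀ i, e i ∈ C) ∧
    ∀ i, G.IsLink (e i) (v i) (v (i + 1))

/-- `M` is a graphic matroid: its elements are the edges of a finite multigraph (loops and parallel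
edges allowed), and the independent sets are the edge sets of forests. -/
def IsGraphic {E : Type*} (M : Matroid E) : Prop :=
  ∃ (V : Type) (_ : Finite V) (G : Graph V E),
    M.E = G.edgeSet ∧ ∀ I : Set E, M.Indep I ↔ I ⊆ G.edgeSet ∧ ¬ ContainsCycle G I

/-- `M` is a transversal matroid: there is a bipartite graph (with adjacency `N`) between the
elements and a finite set `V` such that a set is independent iff it can be matched into `V`. -/
def IsTransversal {E : Type*} (M : Matroid E) : Prop :=
  ∃ (V : Type) (_ : Finite V) (N : E → V → Prop),
    ∀ I : Set E, M.Indep I ↔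
      I ⊆ M.E ∧ ∃ f : I → V, Function.Injective f ∧ ∀ i : I, N i (f i)

/-! ### Pairwise-independent online contention resolution schemes -/

/-- The matroid polytope `{x ≥ 0 | x(S) ≤ rank(S) for all S}`. -/
def matroidPolytope {E : Type*} (M : Matroid E) : Set (E → ℝ) :=
  {x | (∀ i, 0 ≤ x i) ∧ ∀ S : Finset E, ∑ i ∈ S, x i ≤ ((M.eRk (S : Set E)).toNat : ℝ)}

/-- The distribution `D` of a random set `R` is PI-consistent with `x`: `Pr[i ∈ R] = x i`, and
`Pr[i ∈ R, j ∈ R] = x i * x j` for `i ≠ j`. -/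
def PIConsistent {E : Type*} (D : PMF (Set E)) (x : E → ℝ) : Prop :=
  (∀ i, D.toOuterMeasure {R | i ∈ R} = ENNReal.ofReal (x i)) ∧
  ∀ i j, i ≠ j → D.toOuterMeasure {R | i ∈ R ∧ j ∈ R} = ENNReal.ofReal (x i * x j)

/-- A greedy PI-OCRS for `M`. Knowing the distribution `D` of the active set, it draws, before
the elements arrive, a random down-closed family of independent sets (down-closed families
contain `∅`). It then accepts an arriving active element `e` iff the set `I` accepted so far
satisfies `I ∪ {e} ∈ F`; thus it is determined by the law `family D` of `F`. -/
structure GreedyPIOCRS {E : Type*} (M : Matroid E) where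
  family : PMF (Set E) → PMF (Set (Set E))
  empty_mem : ∀ D, ∀ F ∈ (family D).support, ∅ ∈ F
  down_closed : ∀ D, ∀ F ∈ (family D).support, ∀ I ∈ F, ∀ J, J ⊆ I → J ∈ F
  indep : ∀ D, ∀ F ∈ (family D).support, ∀ I ∈ F, M.Indep I

/-- The joint law of the active set `R` and the feasible family `F` drawn independently of `R`. -/
noncomputable def GreedyPIOCRS.joint {E : Type*} {M : Matroid E} (π : GreedyPIOCRS M)
    (D : PMF (Set E)) : PMF (Set E × Set (Set E)) :=
  D.bind fun R => (π.family D).map fun F => (R, F)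

/-- `(b, c)`-selectability: for `x ∈ b • P_M`, `D` PI-consistent with `x` and every `i`,
`Pr[I ∪ {i} ∈ F for all I ∈ F with I ⊆ R | i ∈ R] ≥ c`, written with the denominator `Pr[i ∈ R]`
multiplied out (so that nothing is required of an `i` that is never active). -/
def GreedyPIOCRS.IsSelectable {E : Type*} {M : Matroid E} (π : GreedyPIOCRS M) (b c : ℝ) : Prop :=
  ∀ y ∈ matroidPolytope M, ∀ D : PMF (Set E), PIConsistent D (b • y) → ∀ i : E,
    ENNReal.ofReal c * D.toOuterMeasure {R | i ∈ R} ≤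
      (π.joint D).toOuterMeasure
        {p | i ∈ p.1 ∧ ∀ I ∈ p.2, I ⊆ p.1 → I ∪ {i} ∈ p.2}

/-- There is a `c`-selectable, that is `(1, c)`-selectable, PI-OCRS for `M`. -/
def HasSelectablePIOCRS {E : Type*} (M : Matroid E) (c : ℝ) : Prop :=
  ∃ π : GreedyPIOCRS M, π.IsSelectable 1 c

/-! ### Prophet inequalities against the almighty adversary -/

/-- An order in which all elements of `E` arrive. -/
def ArrivalOrder (E : Type*) : Type _ :=
  {l : List E // l.Nodup ∧ ∀ i, i ∈ l}

/-- A randomized online algorithm. Its random coins are a point of the probability space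
`(Seed, law)`. `accept s I h a` says whether, with coins `s`, set `I` selected so far and list `h`
of earlier arrivals (elements with their weights), it selects the arriving `a = (element, weight)`.
It sees nothing of the weights or the identities of later arrivals. -/
structure OnlineAlgorithm (E : Type*) where
  Seed : Type
  [measurableSpace : MeasurableSpace Seed]
  law : MeasureTheory.Measure Seed
  [isProbabilityMeasure : MeasureTheory.IsProbabilityMeasure law]
  accept : Seed → Set E → List (E × ℝ≥0) → E × ℝ≥0 → Prop
  measurable_accept : ∀ (I : Set E) (h : List E) (i : E),
    MeasurableSet {p : Seed × (E → ℝ≥0) | accept p.1 I (h.map fun j => (j, p.2 j)) (i, p.2 i)}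

attribute [instance] OnlineAlgorithm.measurableSpace OnlineAlgorithm.isProbabilityMeasure

namespace OnlineAlgorithm

variable {E : Type*}

open Classical in
/-- The set selected at the end, starting from the set `I` selected so far, the past arrivals `h`
and the list of arrivals still to come. -/
noncomputable def run (A : OnlineAlgorithm E) (s : A.Seed) :
    Set E → List (E × ℝ≥0) → List (E × ℝ≥0) → Set E
  | I, _, [] => I
  | I, h, a :: l => A.run s (if A.accept s I h a then I ∪ {a.1} else I) (h ++ [a]) l

/-- The set selected with coins `s` if the elements have weights `w` and arrive in order `o`. -/
noncomputable def selected (A : OnlineAlgorithm E) (s : A.Seed) (w : E → ℝ≥0)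
    (o : ArrivalOrder E) : Set E :=
  A.run s ∅ [] (o.1.map fun i => (i, w i))

/-- The algorithm always selects an independent set of `M`. -/
def IsFeasible (A : OnlineAlgorithm E) (M : Matroid E) : Prop :=
  ∀ s w o, M.Indep (A.selected s w o)

end OnlineAlgorithm

/-- The total weight of the set `I`. -/
noncomputable def weight {E : Type*} [Fintype E] (w : E → ℝ≥0) (I : Set E) : ℝ≥0∞ :=
  ∑ i, I.indicator (fun j => (w j : ℝ≥0∞)) i

/-- The offline optimum: the expected maximum weight of an independent set. -/
noncomputable def OPT {E : Type*} [Fintype E] (M : Matroid E)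
    (μ : MeasureTheory.Measure (E → ℝ≥0)) : ℝ≥0∞ :=
  ∫⁻ w, ⨆ I : {I : Set E // M.Indep I}, weight w I.1 ∂μ

/-- `c`-approximate prophet inequality for `M` against the almighty adversary. For every joint
distribution `μ` of pairwise independent nonnegative weights (known to the gambler) there is a
randomized online algorithm, always selecting an independent set, that earns at least `c * OPT` in
expectation, even if an adversary who knows all realized weights and all random coins of the
algorithm chooses the arrival order. (An order achieving the minimum reward for each outcome is a
possible strategy; strategies need not be measurable, and for these the integral is the
lower integral.) -/
def HasAlmightyProphetInequality {E : Type*} [Fintype E] (M : Matroid E) (c : ℝ) : Prop :=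
  ∀ μ : MeasureTheory.Measure (E → ℝ≥0), MeasureTheory.IsProbabilityMeasure μ →
    (∀ i j, i ≠ j → ProbabilityTheory.IndepFun (fun w : E → ℝ≥0 => w i) (fun w => w j) μ) →
    ∃ A : OnlineAlgorithm E, A.IsFeasible M ∧
      ∀ adversary : A.Seed → (E → ℝ≥0) → ArrivalOrder E,
        ENNReal.ofReal c * OPT M μ ≤
          ∫⁻ p : A.Seed × (E → ℝ≥0),
            weight p.2 (A.selected p.1 p.2 (adversary p.1 p.2)) ∂(A.law.prod μ)

end PIProphet

namespace PIProphet

open MeasureTheory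

/-! The whole theorem rests on random colourings. Each element independently receives at most one
random colour, and a set is admitted iff its elements have distinct colours; the colouring rule is
built so that all such sets are independent. An active element `i` of colour `v` can then be blocked
only by another active element of colour `v`. By the union bound this happens with conditional
probability at most the expected load `∑ j, x j * p j v ≤ K`. So `i` is active with a colour of its
own with probability at least `x i * b * (1 - K)`. The bound involves only pairs of elements, which
is why pairwise independence suffices (`le_measure_inter_uniqueColor`).

For the prophet inequality, fix a measurable optimal set. Element `i` declares itself active with
the conditional probability, given its own weight, that it is in that set. Activity depends only on
the element's weight and its own coin, so it is again pairwise independent, and its marginals lie in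
the matroid polytope. An active element with a colour of its own is selected in every arrival order,
so even the almighty adversary cannot prevent it.

It remains to build colourings. If `x` splits into a fractional matching `y` to colours with column
loads at most `L`, then `p i v = b * y i v / x i` has load `b * L` and yields `b * (1 - b * L)`. For
laminar matroids the elements are merged into groups of load at most 2; for graphic ones each edge
is assigned to an end, peeling off vertices of small fractional degree; both give `L = 2`. For
transversal ones a fractional Hall theorem gives `L = 1`. -/

/-- An `E`-indexed colouring rule with colours in a finite set `V`: element `i` gets colour `v` with
probability `p i v`, and no colour with the remaining probability. Elements which may receive
pairwise distinct colours form an independent set, elements `i` with `x i ≠ 0` are coloured with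
probability `b`, and each colour has expected load at most `K` under the activation
probabilities `x`. -/
structure ContentionColoring {E : Type*} [Fintype E] (M : Matroid E) (x : E → ℝ≥0)
    (b K : ℝ≥0) where
  V : Type
  [fintypeV : Fintype V]
  p : E → V → ℝ≥0
  sum_le_one : ∀ i, ∑ v, p i v ≤ 1
  sum_eq : ∀ i, x i ≠ 0 → ∑ v, p i v = b
  load_le : ∀ v, ∑ j, x j * p j v ≤ K
  indep : ∀ (I : Set E) (f : E → V), Set.InjOn f I → (∀ i ∈ I, p i (f i) ≠ 0) → M.Indep I

attribute [instance] ContentionColoring.fintypeV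

/-- All activation probabilities in the matroid polytope admit a contention colouring. -/
def HasContentionColorings {E : Type*} [Fintype E] (M : Matroid E) (b K : ℝ≥0) : Prop :=
  ∀ x : E → ℝ≥0, (fun i => (x i : ℝ)) ∈ matroidPolytope M → Nonempty (ContentionColoring M x b K)

/-! ### The union bound -/

/-- The event that element `i` receives a colour that no other element receives, where `H i v` is
the event that `i` receives colour `v`. -/
def uniqueColor {E V Ω : Type*} (H : E → V → Set Ω) (i : E) : Set Ω :=
  {ω | ∃ v, ω ∈ H i v ∧ ∀ j, j ≠ i → ω ∉ H j v}

theorem measurableSet_uniqueColor {E V Ω : Type*} [Finite E] [Finite V] [MeasurableSpace Ω]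
    {H : E → V → Set Ω} (hH : ∀ i v, MeasurableSet (H i v)) (i : E) :
    MeasurableSet (uniqueColor H i) := by
  have : uniqueColor H i = ⋃ v, (H i v ∩ ⋂ j, ⋂ (_ : j ≠ i), (H j v)ᶜ) := by
    ext ω; simp [uniqueColor]
  rw [this]
  exact .iUnion fun v => (hH i v).inter (.iInter fun j => .iInter fun _ => (hH j v).compl)

/-- For each colour `v`, the event that `i` has `v` and shares it is covered by the events that `j`
has it too, of total measure at most `t * p i v * K`; summing over the disjoint colour events gives
`t * b * (1 - K)`. The contention scheme uses `T = univ`; the prophet inequality takes for `T` the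
event that the weight of `i` lies in a given set. -/
theorem le_measure_inter_uniqueColor {E V Ω : Type*} [Fintype E] [Fintype V] [MeasurableSpace Ω]
    (P : Measure Ω) {H : E → V → Set Ω} (hH : ∀ i v, MeasurableSet (H i v))
    (hd : ∀ i v v', v ≠ v' → Disjoint (H i v) (H i v')) {T : Set Ω} (hT : MeasurableSet T)
    {i : E} {t : ℝ≥0∞} (ht : t ≠ ∞) {p : E → V → ℝ≥0} {x : E → ℝ≥0} {b K c : ℝ≥0}
    (h1 : ∀ v, P (T ∩ H i v) = t * p i v)
    (h2 : ∀ j, j ≠ i → ∀ v, P (T ∩ (H i v ∩ H j v)) ≤ t * p i v * (x j * p j v))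
    (hb : ∑ v, p i v = b) (hK : ∀ v, ∑ j, x j * p j v ≤ K) (hc : c + b * K ≤ b) :
    c * t ≤ P (T ∩ uniqueColor H i) := by
  classical
  set G : V → Set Ω := fun v => H i v ∩ ⋂ j, ⋂ (_ : j ≠ i), (H j v)ᶜ with hG
  have hGm : ∀ v, MeasurableSet (G v) := fun v =>
    (hH i v).inter (.iInter fun j => .iInter fun _ => (hH j v).compl)
  have hgood : T ∩ uniqueColor H i = ⋃ v, T ∩ G v := by
    ext ω; simp [uniqueColor, hG]
  have hsum : P (T ∩ uniqueColor H i) = ∑ v, P (T ∩ G v) := by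
    rw [hgood, measure_iUnion _ fun v => hT.inter (hGm v), tsum_fintype]
    intro v v' hv
    exact (hd i v v' hv).mono (fun ω h => h.2.1) (fun ω h => h.2.1)
  -- The loss stays on the right-hand side, avoiding truncated subtraction; likewise the assumption
  -- on `c` is additive. The sum over `j ≠ i` is enlarged to all `j`.
  have key : ∀ v, t * p i v ≤ P (T ∩ G v) + t * p i v * K := by
    intro v
    rw [← h1 v]
    have hsub : T ∩ H i v ⊆ (T ∩ G v) ∪ ⋃ j ∈ Finset.univ.erase i, T ∩ (H i v ∩ H j v) := by
      rintro ω ⟨hω, hωi⟩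
      by_cases h : ∀ j, j ≠ i → ω ∉ H j v
      · left; exact ⟨hω, hωi, by simpa using h⟩
      · push Not at h
        obtain ⟨j, hj, hωj⟩ := h
        right
        simp only [Set.mem_iUnion]
        exact ⟨j, by simpa using hj, hω, hωi, hωj⟩
    refine (measure_mono hsub).trans ((measure_union_le _ _).trans ?_)
    gcongr
    refine (measure_biUnion_finset_le _ _).trans ?_
    rw [h1 v]
    calc ∑ j ∈ Finset.univ.erase i, P (T ∩ (H i v ∩ H j v))
        ≤ ∑ j ∈ Finset.univ.erase i, t * p i v * (x j * p j v) :=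
          Finset.sum_le_sum fun j hj => h2 j (by simpa using hj) v
      _ = t * p i v * ∑ j ∈ Finset.univ.erase i, (x j * p j v : ℝ≥0∞) := by rw [Finset.mul_sum]
      _ ≤ t * p i v * ∑ j, (x j * p j v : ℝ≥0∞) := by
          gcongr; exact Finset.subset_univ _
      _ ≤ t * p i v * K := by
          gcongr
          exact_mod_cast hK v
  have hall : t * b ≤ P (T ∩ uniqueColor H i) + t * b * K := by
    have := Finset.sum_le_sum fun v (_ : v ∈ Finset.univ) => key v
    rw [Finset.sum_add_distrib, ← hsum, ← Finset.sum_mul, ← Finset.mul_sum] at this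
    have hb' : ∑ v, (p i v : ℝ≥0∞) = b := by exact_mod_cast hb
    rwa [hb'] at this
  have hc' : (c : ℝ≥0∞) + b * K ≤ b := by exact_mod_cast hc
  have hfin : t * b * K ≠ ∞ := ENNReal.mul_ne_top (ENNReal.mul_ne_top ht (by simp)) (by simp)
  rw [← ENNReal.add_le_add_iff_right hfin]
  calc c * t + t * b * K = t * (c + b * K) := by ring
    _ ≤ t * b := by gcongr
    _ ≤ _ := hall

/-! ### The law of a colouring -/

instance optionMeasurableSpace (V : Type*) : MeasurableSpace (Option V) := ⊤

instance optionDiscreteMeasurableSpace (V : Type*) : DiscreteMeasurableSpace (Option V) :=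
  ⟨fun _ => trivial⟩

/-- The law of a random element of `V` with subprobability weights `p`; no element is chosen with
the remaining probability. -/
noncomputable def colorLaw {V : Type*} [Fintype V] (p : V → ℝ≥0) (hp : ∑ v, p v ≤ 1) :
    PMF (Option V) :=
  PMF.ofFintype (fun o => o.elim (1 - ∑ v, (p v : ℝ≥0∞)) fun v => p v) <| by
    rw [Fintype.sum_option]
    exact tsub_add_cancel_of_le (by exact_mod_cast hp)

theorem colorLaw_toMeasure_some {V : Type*} [Fintype V] (p : V → ℝ≥0) (hp : ∑ v, p v ≤ 1) (v : V) :
    (colorLaw p hp).toMeasure {some v} = p v := by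
  rw [PMF.toMeasure_apply_singleton _ _ (measurableSet_singleton _)]
  rfl

theorem pi_apply_eval {ι : Type*} [Fintype ι] {X : ι → Type*} [∀ i, MeasurableSpace (X i)]
    (m : ∀ i, Measure (X i)) [∀ i, IsProbabilityMeasure (m i)] (i : ι) {A : Set (X i)}
    (hA : MeasurableSet A) : Measure.pi m {s | s i ∈ A} = m i A :=
  (measurePreserving_eval m i).measure_preimage hA.nullMeasurableSet

theorem pi_apply_eval_pair {ι : Type*} [Fintype ι] {X : ι → Type*} [∀ i, MeasurableSpace (X i)]
    (m : ∀ i, Measure (X i)) [∀ i, IsProbabilityMeasure (m i)] {i j : ι} (hij : i ≠ j)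
    {A : Set (X i)} {B : Set (X j)} (hA : MeasurableSet A) (hB : MeasurableSet B) :
    Measure.pi m {s | s i ∈ A ∧ s j ∈ B} = m i A * m j B := by
  have h := (ProbabilityTheory.iIndepFun_pi (μ := m) (X := fun i => (id : X i → X i))
    fun i => aemeasurable_id).indepFun hij
  have := h.measure_inter_preimage_eq_mul A B hA hB
  rw [← pi_apply_eval m i hA, ← pi_apply_eval m j hB]
  exact this

namespace ContentionColoring

variable {E : Type*} [Fintype E] {M : Matroid E} {x : E → ℝ≥0} {b K : ℝ≥0}

/-- The sets of elements which the colouring `g` gives distinct, possible colours. -/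
def rainbow (χ : ContentionColoring M x b K) (g : E → Option χ.V) : Set (Set E) :=
  {I | Set.InjOn g I ∧ ∀ i ∈ I, ∃ v, g i = some v ∧ χ.p i v ≠ 0}

theorem indep_of_mem_rainbow (χ : ContentionColoring M x b K) {g : E → Option χ.V} {I : Set E}
    (hI : I ∈ χ.rainbow g) : M.Indep I := by
  classical
  obtain ⟨hinj, hcol⟩ := hI
  -- There may be no colours at all, so the empty set is treated apart; otherwise `v₀` is a filler
  -- for uncoloured elements, none of which lie in `I`.
  rcases I.eq_empty_or_nonempty with rfl | ⟨i₀, hi₀⟩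
  · exact M.empty_indep
  obtain ⟨v₀, -⟩ := hcol i₀ hi₀
  have hf : ∀ i ∈ I, g i = some ((g i).getD v₀) := fun i hi => by
    obtain ⟨v, hv, -⟩ := hcol i hi; simp [hv]
  refine χ.indep I (fun i => (g i).getD v₀) (fun i hi j hj h => hinj hi hj ?_) fun i hi => ?_
  · rw [hf i hi, hf j hj]; exact congrArg some h
  · obtain ⟨v, hv, hp⟩ := hcol i hi
    simpa [hv] using hp

theorem mem_rainbow_of_subset (χ : ContentionColoring M x b K) {g : E → Option χ.V} {I J : Set E}
    (hI : I ∈ χ.rainbow g) (hJ : J ⊆ I) : J ∈ χ.rainbow g :=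
  ⟨hI.1.mono hJ, fun i hi => hI.2 i (hJ hi)⟩

theorem empty_mem_rainbow (χ : ContentionColoring M x b K) (g : E → Option χ.V) :
    ∅ ∈ χ.rainbow g :=
  ⟨Set.injOn_empty _, by simp⟩

theorem union_singleton_mem_rainbow (χ : ContentionColoring M x b K) {g : E → Option χ.V}
    {I : Set E} (hI : I ∈ χ.rainbow g) {i : E} {v : χ.V} (hv : g i = some v) (hp : χ.p i v ≠ 0)
    (h : ∀ j ∈ I, j ≠ i → g j ≠ some v) : I ∪ {i} ∈ χ.rainbow g := by
  refine ⟨?_, ?_⟩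
  · rintro j (hj | rfl) k (hk | rfl) hjk
    · exact hI.1 hj hk hjk
    · by_contra hne
      exact h j hj hne (hjk.trans hv)
    · by_contra hne
      exact h k hk (Ne.symm hne) (hjk.symm.trans hv)
    · rfl
  · rintro j (hj | rfl)
    · exact hI.2 j hj
    · exact ⟨v, hv, hp⟩

/-- The random colouring, with the colours of the elements independent of each other. -/
noncomputable def law (χ : ContentionColoring M x b K) : Measure (E → Option χ.V) :=
  Measure.pi fun i => (colorLaw (χ.p i) (χ.sum_le_one i)).toMeasure

instance (χ : ContentionColoring M x b K) : IsProbabilityMeasure χ.law := by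
  unfold law; infer_instance

/-- The random family of rainbow sets. -/
noncomputable def familyLaw (χ : ContentionColoring M x b K) : PMF (Set (Set E)) :=
  (χ.law.toPMF).map χ.rainbow

end ContentionColoring

/-! ### The contention resolution scheme -/

section OCRS

variable {E : Type*} [Fintype E] {M : Matroid E} {b K : ℝ≥0}

/-- The activation probabilities of a random set. -/
noncomputable def marginal (D : PMF (Set E)) (i : E) : ℝ≥0 :=
  (D.toOuterMeasure {R | i ∈ R}).toNNReal

open Classical in
/-- The greedy scheme which accepts a set iff its elements have distinct colours. -/
noncomputable def coloringOCRS (h : HasContentionColorings M b K) : GreedyPIOCRS M where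
  family D :=
    if hx : (fun i => (marginal D i : ℝ)) ∈ matroidPolytope M then (h _ hx).some.familyLaw
    -- Selectability demands nothing when the marginals are outside the polytope.
    else PMF.pure {∅}
  empty_mem D F hF := by
    split_ifs at hF with hx
    · obtain ⟨g, -, rfl⟩ := (PMF.mem_support_map_iff _ _ _).1 hF
      exact ContentionColoring.empty_mem_rainbow _ _
    · simp_all
  down_closed D F hF I hI J hJ := by
    split_ifs at hF with hx
    · obtain ⟨g, -, rfl⟩ := (PMF.mem_support_map_iff _ _ _).1 hF
      exact ContentionColoring.mem_rainbow_of_subset _ hI hJ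
    · simp_all
  indep D F hF I hI := by
    split_ifs at hF with hx
    · obtain ⟨g, -, rfl⟩ := (PMF.mem_support_map_iff _ _ _).1 hF
      exact ContentionColoring.indep_of_mem_rainbow _ hI
    · simp_all

/-- Transfers the joint law of active set and family to the product of active set and colouring,
where the union bound is available. -/
theorem bind_map_toOuterMeasure {α β γ : Type*} [Fintype α] [MeasurableSpace α]
    [DiscreteMeasurableSpace α] [Countable β] [MeasurableSpace β] [DiscreteMeasurableSpace β]
    (D : PMF α) (m : Measure β) [IsProbabilityMeasure m] (f : β → γ) (S : Set (α × γ)) :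
    (D.bind fun a => (m.toPMF.map f).map fun c => (a, c)).toOuterMeasure S =
      (D.toMeasure.prod m) {q | (q.1, f q.2) ∈ S} := by
  rw [PMF.toOuterMeasure_bind_apply, tsum_fintype, Measure.prod_apply (.of_discrete),
    lintegral_fintype]
  refine Finset.sum_congr rfl fun a _ => ?_
  rw [PMF.toOuterMeasure_map_apply, PMF.toOuterMeasure_map_apply,
    ← PMF.toMeasure_apply_eq_toOuterMeasure, Measure.toPMF_toMeasure,
    PMF.toMeasure_apply_singleton _ _ (measurableSet_singleton _), mul_comm]
  rfl

/-- A rainbow set of active elements fails to extend by a properly coloured `i` only if it contains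
another element of that colour. Hence the selectability event contains the event that `i` is active
with a colour no other active element has. -/
theorem hasSelectablePIOCRS_of_colorings (h : HasContentionColorings M b K) {c : ℝ≥0}
    (hc : c + b * K ≤ b) : HasSelectablePIOCRS M c := by
  classical
  refine ⟨coloringOCRS h, fun y hy D hD i => ?_⟩
  rw [one_smul] at hD
  have hxy : ∀ j, (marginal D j : ℝ) = y j := fun j => by
    rw [marginal, hD.1 j]; exact Real.coe_toNNReal _ (hy.1 j)
  have hmarg : ∀ j, D.toOuterMeasure {R | j ∈ R} = marginal D j := fun j => by
    rw [hD.1 j, ← hxy j, ENNReal.ofReal_coe_nnreal]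
  have hpair : ∀ j k, j ≠ k →
      D.toOuterMeasure {R | j ∈ R ∧ k ∈ R} = marginal D j * marginal D k := fun j k hjk => by
    rw [hD.2 j k hjk, ← hxy j, ← hxy k, ← NNReal.coe_mul, ENNReal.ofReal_coe_nnreal,
      ENNReal.coe_mul]
  have hx : (fun j => (marginal D j : ℝ)) ∈ matroidPolytope M := by
    rw [funext hxy]; exact hy
  set χ := (h _ hx).some
  have hfam : (coloringOCRS h).family D = χ.law.toPMF.map χ.rainbow := by
    simp only [coloringOCRS, dif_pos hx]; rfl
  rw [GreedyPIOCRS.joint, hfam, bind_map_toOuterMeasure, ENNReal.ofReal_coe_nnreal, hmarg i]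
  rcases eq_or_ne (marginal D i) 0 with h0 | h0
  · simp [h0]
  let H : E → χ.V → Set (Set E × (E → Option χ.V)) := fun j v =>
    {R | j ∈ R} ×ˢ {g | g j ∈ {o | o = some v ∧ χ.p j v ≠ 0}}
  -- Independence is required of every family in the support, so impossible colours are excluded
  -- explicitly; this changes no probability.
  have hcol : ∀ j v, (colorLaw (χ.p j) (χ.sum_le_one j)).toMeasure {o | o = some v ∧ χ.p j v ≠ 0}
      = χ.p j v := fun j v => by
    by_cases hp : χ.p j v = 0
    · simp [hp]
    · rw [← colorLaw_toMeasure_some (χ.p j) (χ.sum_le_one j) v]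
      congr 1; ext o; simp [hp]
  have hle := le_measure_inter_uniqueColor (D.toMeasure.prod χ.law) (H := H)
    (fun _ _ => .of_discrete) (fun j v v' hv => Set.disjoint_left.2 ?_) (T := Set.univ) .univ
    (i := i) (t := marginal D i) (by simp) (p := χ.p) (x := marginal D) (b := b) (K := K) (c := c)
    (fun v => ?_) (fun j hj v => ?_) (χ.sum_eq i h0) χ.load_le hc
  · refine hle.trans (measure_mono ?_)
    rintro ⟨R, g⟩ ⟨-, v, hv, hv'⟩
    simp only [H, Set.mem_prod, Set.mem_ofPred_eq] at hv hv'
    refine ⟨hv.1, fun I hI hIR => χ.union_singleton_mem_rainbow hI hv.2.1 hv.2.2 ?_⟩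
    intro j hj hji hjv
    obtain ⟨w, hw, hpw⟩ := hI.2 j hj
    obtain rfl : v = w := Option.some.inj (hjv.symm.trans hw)
    exact hv' j hji ⟨hIR hj, hjv, hpw⟩
  · rintro ⟨R, g⟩ h1 h2
    simp only [H, Set.mem_prod, Set.mem_ofPred_eq] at h1 h2
    exact hv (by simpa using h1.2.1.symm.trans h2.2.1)
  · rw [Set.univ_inter, Measure.prod_prod, PMF.toMeasure_apply_eq_toOuterMeasure, hmarg,
      ContentionColoring.law, pi_apply_eval _ _ .of_discrete, hcol]
  -- PI-consistency for pairs gives the factor `x i * x j`, and the independent colours give the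
  -- other two factors.
  · have : H i v ∩ H j v = {R | i ∈ R ∧ j ∈ R} ×ˢ {g | g i ∈ {o | o = some v ∧ χ.p i v ≠ 0} ∧
        g j ∈ {o | o = some v ∧ χ.p j v ≠ 0}} := by
      ext ⟨R, g⟩; simp [H]; tauto
    rw [Set.univ_inter, this, Measure.prod_prod, PMF.toMeasure_apply_eq_toOuterMeasure,
      hpair i j hj.symm, ContentionColoring.law,
      pi_apply_eval_pair _ hj.symm .of_discrete .of_discrete, hcol, hcol]
    apply le_of_eq; ring

end OCRS

/-! ### A measurable offline optimum -/

theorem measurable_weight {E : Type*} [Fintype E] (I : Set E) :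
    Measurable fun w : E → ℝ≥0 => weight w I := by
  classical
  unfold weight
  refine Finset.measurable_sum _ fun i _ => ?_
  by_cases hi : i ∈ I
  · simpa [hi] using (measurable_pi_apply i).coe_nnreal_ennreal
  · simp [hi]

/-- Ties are broken by the least index in an enumeration, which makes the choice measurable. -/
theorem exists_measurable_argmax {Ω ι : Type*} [MeasurableSpace Ω] [Finite ι] [Nonempty ι]
    {f : ι → Ω → ℝ≥0∞} (hf : ∀ i, Measurable (f i)) :
    ∃ o : Ω → ι, (∀ i, MeasurableSet {ω | o ω = i}) ∧ ∀ ω i, f i ω ≤ f (o ω) ω := by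
  classical
  obtain ⟨n, ⟨e⟩⟩ := Finite.exists_equiv_fin ι
  have hmax : ∀ ω, ∃ k : ℕ, ∃ hk : k < n, ∀ i, f i ω ≤ f (e.symm ⟨k, hk⟩) ω := fun ω => by
    obtain ⟨i, hi⟩ := Finite.exists_max fun i => f i ω
    exact ⟨e i, (e i).2, by simpa using hi⟩
  have hm : Measurable fun ω => Nat.find (hmax ω) := by
    refine measurable_find _ fun k => ?_
    by_cases hk : k < n
    · simp only [hk, exists_true_left, Set.ofPred_forall]
      exact .iInter fun i => measurableSet_le (hf i) (hf _)
    · simp [hk]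
  refine ⟨fun ω => e.symm ⟨Nat.find (hmax ω), (Nat.find_spec (hmax ω)).1⟩, fun i => ?_,
    fun ω => (Nat.find_spec (hmax ω)).2⟩
  convert hm (measurableSet_singleton ((e i : ℕ))) using 1
  ext ω
  simp [Equiv.symm_apply_eq, Fin.ext_iff]

theorem exists_measurable_optimum {E : Type*} [Fintype E] (M : Matroid E) :
    ∃ O : (E → ℝ≥0) → Set E, (∀ i, MeasurableSet {w | i ∈ O w}) ∧ (∀ w, M.Indep (O w)) ∧
      ∀ w (I : Set E), M.Indep I → weight w I ≤ weight w (O w) := by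
  have : Nonempty {I : Set E // M.Indep I} := ⟨⟨∅, M.empty_indep⟩⟩
  obtain ⟨o, ho, hmax⟩ := exists_measurable_argmax (ι := {I : Set E // M.Indep I})
    (f := fun I w => weight w I.1) fun I => measurable_weight I.1
  refine ⟨fun w => (o w).1, fun i => ?_, fun w => (o w).2, fun w I hI => hmax w ⟨I, hI⟩⟩
  have : {w | i ∈ (o w).1} = ⋃ I : {I : {I : Set E // M.Indep I} // i ∈ I.1}, {w | o w = I.1} := by
    ext w; simp
  rw [this]
  exact .iUnion fun I => ho _

/-- Pointwise, an independent set meets `S` in at most rank-many elements; taking expectations gives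
the rank inequality. -/
theorem measure_mem_indep_mem_matroidPolytope {E Ω : Type*} [Fintype E] [MeasurableSpace Ω]
    (M : Matroid E) (μ : Measure Ω) [IsProbabilityMeasure μ] {O : Ω → Set E}
    (hO : ∀ i, MeasurableSet {ω | i ∈ O ω}) (hI : ∀ ω, M.Indep (O ω)) :
    (fun i => ((μ {ω | i ∈ O ω}).toNNReal : ℝ)) ∈ matroidPolytope M := by
  classical
  refine ⟨fun i => NNReal.coe_nonneg _, fun S => ?_⟩
  have hrk : M.eRk (S : Set E) ≠ ⊤ :=
    ne_top_of_le_ne_top (Set.encard_ne_top_iff.2 S.finite_toSet) (M.eRk_le_encard _)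
  have hpt : ∀ ω, ∑ i ∈ S, ({ω | i ∈ O ω} : Set Ω).indicator (1 : Ω → ℝ≥0∞) ω
      ≤ ((M.eRk (S : Set E)).toNat : ℝ≥0∞) := fun ω => by
    have h := ((hI ω).subset (Set.inter_subset_left (t := (S : Set E)))).encard_le_eRk_of_subset
      Set.inter_subset_right
    have hc : (O ω ∩ (S : Set E)) = ((S.filter fun i => i ∈ O ω : Finset E) : Set E) := by
      ext i; simp [and_comm]
    rw [hc, Set.encard_coe_eq_coe_finsetCard] at h
    have h' : (S.filter fun i => i ∈ O ω).card ≤ (M.eRk (S : Set E)).toNat := by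
      rw [← ENat.natCast_toNat hrk] at h
      exact_mod_cast h
    simp only [Set.indicator_apply, Set.mem_ofPred_eq, Pi.one_apply, Finset.sum_boole]
    exact_mod_cast h'
  have hsum : ∑ i ∈ S, μ {ω | i ∈ O ω} ≤ ((M.eRk (S : Set E)).toNat : ℝ≥0∞) := by
    calc ∑ i ∈ S, μ {ω | i ∈ O ω}
        = ∑ i ∈ S, ∫⁻ ω, ({ω | i ∈ O ω} : Set Ω).indicator 1 ω ∂μ :=
          Finset.sum_congr rfl fun i _ => (lintegral_indicator_one (hO i)).symm
      _ = ∫⁻ ω, ∑ i ∈ S, ({ω | i ∈ O ω} : Set Ω).indicator 1 ω ∂μ :=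
          (lintegral_finsetSum _ fun i _ => measurable_one.indicator (hO i)).symm
      _ ≤ ∫⁻ _, ((M.eRk (S : Set E)).toNat : ℝ≥0∞) ∂μ := lintegral_mono hpt
      _ = _ := by simp
  have hnn : ∑ i ∈ S, (μ {ω | i ∈ O ω}).toNNReal ≤ ((M.eRk (S : Set E)).toNat : ℝ≥0) := by
    rw [← ENNReal.coe_le_coe, ENNReal.ofNNReal_finsetSum]
    simpa only [ENNReal.coe_toNNReal (measure_ne_top μ _), ENNReal.coe_natCast] using hsum
  have hreal := NNReal.coe_le_coe.2 hnn
  rw [NNReal.coe_sum, NNReal.coe_natCast] at hreal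
  exact hreal

/-! ### Conditional probabilities given a single weight -/

/-- The Radon–Nikodym derivative is at most 1 only almost everywhere; truncation gives a genuine
probability at every point, as needed for the activation coin. -/
theorem exists_density_of_le {α : Type*} [MeasurableSpace α] {ν μ : Measure α} [IsFiniteMeasure μ]
    (h : ν ≤ μ) : ∃ q : α → ℝ≥0, Measurable q ∧ (∀ a, q a ≤ 1) ∧
      ν = μ.withDensity fun a => (q a : ℝ≥0∞) := by
  have : IsFiniteMeasure ν := isFiniteMeasure_of_le μ h
  refine ⟨fun a => min 1 (ν.rnDeriv μ a).toNNReal,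
    measurable_const.min (Measure.measurable_rnDeriv ν μ).ennreal_toNNReal,
    fun a => min_le_left _ _, ?_⟩
  rw [← Measure.withDensity_rnDeriv_eq ν μ (Measure.absolutelyContinuous_of_le h)]
  refine withDensity_congr_ae ?_
  rw [Measure.withDensity_rnDeriv_eq ν μ (Measure.absolutelyContinuous_of_le h)]
  filter_upwards [Measure.rnDeriv_le_one_of_le h] with a ha
  have hne : ν.rnDeriv μ a ≠ ∞ := ne_top_of_le_ne_top ENNReal.one_ne_top ha
  rw [min_eq_right]
  · exact (ENNReal.coe_toNNReal hne).symm
  · rw [← ENNReal.coe_le_coe, ENNReal.coe_toNNReal hne]; exact ha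

/-! ### The online algorithm -/

/-- A uniform random number. -/
noncomputable def uniformLaw : Measure ℝ := volume.restrict (Set.Ioc 0 1)

instance : IsProbabilityMeasure uniformLaw := ⟨by simp [uniformLaw]⟩

theorem uniformLaw_Iic {q : ℝ≥0} (hq : q ≤ 1) : uniformLaw (Set.Iic (q : ℝ)) = q := by
  have : Set.Iic (q : ℝ) ∩ Set.Ioc 0 1 = Set.Ioc 0 (q : ℝ) := by
    ext u
    simp only [Set.mem_inter_iff, Set.mem_Iic, Set.mem_Ioc]
    have : (q : ℝ) ≤ 1 := hq
    constructor
    · rintro ⟨h1, h2, -⟩; exact ⟨h2, h1⟩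
    · rintro ⟨h1, h2⟩; exact ⟨h2, h1, h2.trans this⟩
  rw [uniformLaw, Measure.restrict_apply measurableSet_Iic, this]
  simp

theorem OnlineAlgorithm.run_nil {E : Type*} (A : OnlineAlgorithm E) (s : A.Seed) (I : Set E)
    (h : List (E × ℝ≥0)) : A.run s I h [] = I := by
  simp [run]

open Classical in
theorem OnlineAlgorithm.run_cons {E : Type*} (A : OnlineAlgorithm E) (s : A.Seed) (I : Set E)
    (h : List (E × ℝ≥0)) (a : E × ℝ≥0) (l : List (E × ℝ≥0)) :
    A.run s I h (a :: l) =
      A.run s (if A.accept s I h a then I ∪ {a.1} else I) (h ++ [a]) l := by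
  simp [run]

section Algorithm

variable {E : Type*} [Fintype E] {M : Matroid E} {x : E → ℝ≥0} {b K : ℝ≥0}

namespace ContentionColoring

/-- The coins of the online algorithm: a colour and a number in `[0, 1]` for each element. The
elements are numbered so that the coins live in the lowest universe. -/
abbrev Seed (χ : ContentionColoring M x b K) : Type :=
  Fin (Fintype.card E) → Option χ.V × ℝ

/-- The coins of the element `i`. -/
noncomputable def coin (χ : ContentionColoring M x b K) (s : χ.Seed) (i : E) : Option χ.V × ℝ :=
  s (Fintype.equivFin E i)

/-- Element `i` of weight `r` is active and receives the colour `v`. It is active with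
probability `q i r`. -/
def Colored (χ : ContentionColoring M x b K) (q : E → ℝ≥0 → ℝ≥0) (s : χ.Seed) (i : E) (r : ℝ≥0)
    (v : χ.V) : Prop :=
  ((χ.coin s i).1 = some v ∧ χ.p i v ≠ 0) ∧ (χ.coin s i).2 ≤ q i r

/-- The coins are independent, with uniform numbers. -/
noncomputable def seedLaw (χ : ContentionColoring M x b K) : Measure χ.Seed :=
  Measure.pi fun k => (colorLaw (χ.p ((Fintype.equivFin E).symm k))
    (χ.sum_le_one ((Fintype.equivFin E).symm k))).toMeasure.prod uniformLaw

instance (χ : ContentionColoring M x b K) : IsProbabilityMeasure χ.seedLaw := by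
  unfold seedLaw; infer_instance

theorem measurable_coin (χ : ContentionColoring M x b K) (i : E) :
    Measurable fun s => χ.coin s i :=
  measurable_pi_apply _

/-- The event that `i` is active and receives the colour `v`. -/
def coloredEvent (χ : ContentionColoring M x b K) (q : E → ℝ≥0 → ℝ≥0) (i : E) (v : χ.V) :
    Set (χ.Seed × (E → ℝ≥0)) :=
  {ω | χ.Colored q ω.1 i (ω.2 i) v}

theorem measurableSet_coloredEvent (χ : ContentionColoring M x b K) {q : E → ℝ≥0 → ℝ≥0}
    (hq : ∀ i, Measurable (q i)) (i : E) (v : χ.V) : MeasurableSet (χ.coloredEvent q i v) := by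
  have hc : Measurable fun ω : χ.Seed × (E → ℝ≥0) => χ.coin ω.1 i :=
    (χ.measurable_coin i).comp measurable_fst
  refine MeasurableSet.inter ?_ ?_
  · exact (measurable_fst.comp hc) (MeasurableSet.of_discrete (s := {o | o = some v ∧ χ.p i v ≠ 0}))
  · exact measurableSet_le (measurable_snd.comp hc)
      (((hq i).comp ((measurable_pi_apply i).comp measurable_snd)).coe_nnreal_real)

/-- The algorithm which selects an active element iff its colour has not been used yet. -/
noncomputable abbrev algorithm (χ : ContentionColoring M x b K) (q : E → ℝ≥0 → ℝ≥0)
    (hq : ∀ i, Measurable (q i)) : OnlineAlgorithm E where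
  Seed := χ.Seed
  law := χ.seedLaw
  accept s I _ a := ∃ v, χ.Colored q s a.1 a.2 v ∧ ∀ j ∈ I, (χ.coin s j).1 ≠ some v
  measurable_accept I h i := by
    simp only [Set.ofPred_exists, Set.ofPred_and, Set.ofPred_forall]
    refine .iUnion fun v => (χ.measurableSet_coloredEvent hq i v).inter
      (.iInter fun j => .iInter fun _ => ?_)
    exact (measurable_fst.comp ((χ.measurable_coin j).comp measurable_fst))
      (MeasurableSet.of_discrete (s := {o | o ≠ some v}))

variable (χ : ContentionColoring M x b K) {q : E → ℝ≥0 → ℝ≥0} (hq : ∀ i, Measurable (q i))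

theorem run_mem_rainbow (s : χ.Seed) (l : List (E × ℝ≥0)) (I : Set E) (h : List (E × ℝ≥0))
    (hI : I ∈ χ.rainbow fun i => (χ.coin s i).1) :
    (χ.algorithm q hq).run s I h l ∈ χ.rainbow fun i => (χ.coin s i).1 := by
  induction l generalizing I h with
  | nil => rwa [OnlineAlgorithm.run_nil]
  | cons a l ih =>
    rw [OnlineAlgorithm.run_cons]
    refine ih _ _ ?_
    split_ifs with ha
    · obtain ⟨v, hv, hne⟩ := ha
      exact χ.union_singleton_mem_rainbow hI hv.1.1 hv.1.2 fun j hj _ => hne j hj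
    · exact hI

theorem algorithm_isFeasible : (χ.algorithm q hq).IsFeasible M := fun s _ _ =>
  χ.indep_of_mem_rainbow (χ.run_mem_rainbow hq s _ ∅ [] (χ.empty_mem_rainbow _))

/-- The invariant is that all selected elements are active in their colours. Whatever the order,
only such an element could block `i`, and a unique colour rules this out. -/
theorem mem_run (s : χ.Seed) (w : E → ℝ≥0) (l : List E) (I : Set E) (h : List (E × ℝ≥0))
    (hI : ∀ j ∈ I, ∃ v, χ.Colored q s j (w j) v) {i : E} (hi : i ∈ I ∨ i ∈ l)
    (hu : (s, w) ∈ uniqueColor (χ.coloredEvent q) i) :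
    i ∈ (χ.algorithm q hq).run s I h (l.map fun j => (j, w j)) := by
  induction l generalizing I h with
  | nil =>
    rw [List.map_nil, OnlineAlgorithm.run_nil]
    simpa using hi
  | cons a l ih =>
    rw [List.map_cons, OnlineAlgorithm.run_cons]
    refine ih _ _ ?_ ?_
    · split_ifs with ha
      · obtain ⟨v, hv, -⟩ := ha
        rintro j (hj | rfl)
        · exact hI j hj
        · exact ⟨v, hv⟩
      · exact hI
    · rcases hi with hi | hi
      · left; split_ifs
        · exact Or.inl hi
        · exact hi
      rcases List.mem_cons.1 hi with rfl | hi
      · left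
        by_cases hiI : i ∈ I
        · split_ifs
          · exact Or.inl hiI
          · exact hiI
        · rw [if_pos]
          · exact Or.inr rfl
          · obtain ⟨v, hv, hv'⟩ := hu
            refine ⟨v, hv, fun j hj hjv => hv' j (fun h => hiI (h ▸ hj)) ?_⟩
            obtain ⟨u, hu⟩ := hI j hj
            obtain rfl : v = u := Option.some.inj (hjv.symm.trans hu.1.1)
            exact hu
      · exact Or.inr hi

theorem mem_selected_of_mem_uniqueColor {s : χ.Seed} {w : E → ℝ≥0} {i : E}
    (hu : (s, w) ∈ uniqueColor (χ.coloredEvent q) i) (o : ArrivalOrder E) :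
    i ∈ (χ.algorithm q hq).selected s w o :=
  χ.mem_run hq s w o.1 ∅ [] (by simp) (Or.inr (o.2.2 i)) hu

theorem colorLaw_prod_uniformLaw (i : E) (v : χ.V) {r : ℝ≥0} (hr : r ≤ 1) :
    ((colorLaw (χ.p i) (χ.sum_le_one i)).toMeasure.prod uniformLaw)
      {c | (c.1 = some v ∧ χ.p i v ≠ 0) ∧ c.2 ≤ r} = χ.p i v * r := by
  have : {c : Option χ.V × ℝ | (c.1 = some v ∧ χ.p i v ≠ 0) ∧ c.2 ≤ r} =
      {o | o = some v ∧ χ.p i v ≠ 0} ×ˢ Set.Iic (r : ℝ) := rfl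
  rw [this, Measure.prod_prod, uniformLaw_Iic hr]
  congr 1
  by_cases hp : χ.p i v = 0
  · simp [hp]
  · rw [← colorLaw_toMeasure_some (χ.p i) (χ.sum_le_one i) v]
    congr 1; ext o; simp [hp]

theorem measurableSet_coin (i : E) (v : χ.V) (r : ℝ≥0) : MeasurableSet
    {c : Option χ.V × ℝ | (c.1 = some v ∧ χ.p i v ≠ 0) ∧ c.2 ≤ r} :=
  (MeasurableSet.of_discrete (s := {o | o = some v ∧ χ.p i v ≠ 0})).prod measurableSet_Iic

theorem seedLaw_colored (i : E) (v : χ.V) {r : ℝ≥0} (hr : q i r ≤ 1) :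
    χ.seedLaw {s | χ.Colored q s i r v} = χ.p i v * q i r := by
  rw [← χ.colorLaw_prod_uniformLaw i v hr]
  have := pi_apply_eval (fun k => (colorLaw (χ.p ((Fintype.equivFin E).symm k))
    (χ.sum_le_one ((Fintype.equivFin E).symm k))).toMeasure.prod uniformLaw)
    (Fintype.equivFin E i) (χ.measurableSet_coin i v (q i r))
  simp only [Equiv.symm_apply_apply] at this
  exact this

theorem seedLaw_colored_pair {i j : E} (hij : i ≠ j) (v : χ.V) {r t : ℝ≥0} (hr : q i r ≤ 1)
    (ht : q j t ≤ 1) : χ.seedLaw {s | χ.Colored q s i r v ∧ χ.Colored q s j t v} =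
      (χ.p i v * q i r) * (χ.p j v * q j t) := by
  rw [← χ.colorLaw_prod_uniformLaw i v hr, ← χ.colorLaw_prod_uniformLaw j v ht]
  have := pi_apply_eval_pair (fun k => (colorLaw (χ.p ((Fintype.equivFin E).symm k))
    (χ.sum_le_one ((Fintype.equivFin E).symm k))).toMeasure.prod uniformLaw)
    ((Fintype.equivFin E).injective.ne hij) (χ.measurableSet_coin i v (q i r))
    (χ.measurableSet_coin j v (q j t))
  simp only [Equiv.symm_apply_apply] at this
  exact this

end ContentionColoring

/-! ### Reward and optimum in terms of the laws of single weights -/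

/-- The adversary may make `I` non-measurable; the measurable events `G i` provide a measurable
minorant of the reward. -/
theorem lintegral_weight_le {Ω : Type*} [MeasurableSpace Ω] (P : Measure Ω) {W : Ω → E → ℝ≥0}
    (hW : ∀ i, Measurable fun ω => W ω i) {G : E → Set Ω} (hG : ∀ i, MeasurableSet (G i))
    {I : Ω → Set E} (h : ∀ ω i, ω ∈ G i → i ∈ I ω) :
    ∑ i, ∫⁻ r : ℝ≥0, (r : ℝ≥0∞) ∂((P.restrict (G i)).map fun ω => W ω i) ≤
      ∫⁻ ω, weight (W ω) (I ω) ∂P := by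
  classical
  calc ∑ i, ∫⁻ r : ℝ≥0, (r : ℝ≥0∞) ∂((P.restrict (G i)).map fun ω => W ω i)
      = ∑ i, ∫⁻ ω, (G i).indicator (fun ω => (W ω i : ℝ≥0∞)) ω ∂P := by
        refine Finset.sum_congr rfl fun i _ => ?_
        rw [lintegral_map measurable_coe_nnreal_ennreal (hW i), lintegral_indicator (hG i)]
    _ = ∫⁻ ω, ∑ i, (G i).indicator (fun ω => (W ω i : ℝ≥0∞)) ω ∂P :=
        (lintegral_finsetSum _ fun i _ => (hW i).coe_nnreal_ennreal.indicator (hG i)).symm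
    _ ≤ _ := by
        refine lintegral_mono fun ω => Finset.sum_le_sum fun i _ => ?_
        by_cases hi : ω ∈ G i
        · simp [hi, h ω i hi]
        · simp [hi]

/-- Splitting the optimum by element reduces the prophet inequality to comparing, for each `i`, two
measures on the possible weights of `i`. -/
theorem OPT_eq_sum (μ : Measure (E → ℝ≥0)) {O : (E → ℝ≥0) → Set E}
    (hO : ∀ i, MeasurableSet {w | i ∈ O w}) (hind : ∀ w, M.Indep (O w))
    (hmax : ∀ w (I : Set E), M.Indep I → weight w I ≤ weight w (O w)) :
    OPT M μ = ∑ i, ∫⁻ r : ℝ≥0, (r : ℝ≥0∞) ∂((μ.restrict {w | i ∈ O w}).map fun w => w i) := by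
  classical
  have : ∀ w, (⨆ I : {I : Set E // M.Indep I}, weight w I.1) = weight w (O w) := fun w =>
    le_antisymm (iSup_le fun I => hmax w I.1 I.2)
      (le_iSup (fun I : {I : Set E // M.Indep I} => weight w I.1) ⟨O w, hind w⟩)
  rw [OPT]
  simp only [this]
  simp only [weight]
  have hind : ∀ i w, (O w).indicator (fun j => (w j : ℝ≥0∞)) i =
      ({w | i ∈ O w} : Set _).indicator (fun w : E → ℝ≥0 => (w i : ℝ≥0∞)) w := fun i w => rfl
  simp only [hind]
  rw [lintegral_finsetSum _ fun i _ => (measurable_pi_apply i).coe_nnreal_ennreal.indicator (hO i)]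
  refine Finset.sum_congr rfl fun i _ => ?_
  rw [lintegral_map measurable_coe_nnreal_ennreal (measurable_pi_apply i),
    lintegral_indicator (hO i)]

/-- Here `ν i` is the law of the weight of `i` restricted to the event that `i` is in the optimal
set, and `q i` is its density with respect to the law of that weight. Activating with probability `q
i` reproduces `ν i` without seeing other weights. -/
theorem hasAlmightyProphetInequality_of_colorings (h : HasContentionColorings M b K) {c : ℝ≥0}
    (hc : c + b * K ≤ b) : HasAlmightyProphetInequality M c := by
  classical
  intro μ hμ hindep
  obtain ⟨O, hO, hOind, hmax⟩ := exists_measurable_optimum M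
  set ν : E → Measure ℝ≥0 := fun i => (μ.restrict {w | i ∈ O w}).map fun w => w i with hν
  have hdens : ∀ i, ∃ q : ℝ≥0 → ℝ≥0, Measurable q ∧ (∀ a, q a ≤ 1) ∧
      ν i = (μ.map fun w => w i).withDensity fun a => (q a : ℝ≥0∞) := fun i =>
    have : IsProbabilityMeasure (μ.map fun w => w i) :=
      Measure.isProbabilityMeasure_map (measurable_pi_apply i).aemeasurable
    exists_density_of_le (Measure.map_mono Measure.restrict_le_self (measurable_pi_apply i))
  choose q hq hq1 hqν using hdens
  have hνS : ∀ i S, MeasurableSet S →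
      ν i S = ∫⁻ w, S.indicator (fun r => (q i r : ℝ≥0∞)) (w i) ∂μ := fun i S hS => by
    rw [hqν i, withDensity_apply _ hS, ← lintegral_indicator hS,
      lintegral_map ((hq i).coe_nnreal_ennreal.indicator hS) (measurable_pi_apply i)]
  have hνuniv : ∀ i, ν i Set.univ = μ {w | i ∈ O w} := fun i => by
    rw [hν, Measure.map_apply (measurable_pi_apply i) .univ]; simp
  set x : E → ℝ≥0 := fun i => (μ {w | i ∈ O w}).toNNReal with hx
  have hxν : ∀ i, (x i : ℝ≥0∞) = ν i Set.univ := fun i => by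
    rw [hνuniv, hx]; exact ENNReal.coe_toNNReal (measure_ne_top _ _)
  obtain ⟨χ⟩ := h x (measure_mem_indep_mem_matroidPolytope M μ hO hOind)
  refine ⟨χ.algorithm q hq, χ.algorithm_isFeasible hq, fun adversary => ?_⟩
  rw [ENNReal.ofReal_coe_nnreal, OPT_eq_sum μ hO hOind hmax]
  change _ ≤ ∫⁻ p : χ.Seed × (E → ℝ≥0), _ ∂(χ.seedLaw.prod μ)
  have hH := χ.measurableSet_coloredEvent hq
  have hG := measurableSet_uniqueColor hH
  have hW : ∀ i, Measurable fun ω : χ.Seed × (E → ℝ≥0) => ω.2 i := fun i =>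
    (measurable_pi_apply i).comp measurable_snd
  refine le_trans ?_ (lintegral_weight_le (χ.seedLaw.prod μ) hW hG
    fun ω i hi => χ.mem_selected_of_mem_uniqueColor hq hi _)
  rw [Finset.mul_sum]
  refine Finset.sum_le_sum fun i _ => ?_
  rw [← smul_eq_mul, ← lintegral_smul_measure]
  -- The comparison is made between measures: for every set `S` of weights, the union bound is
  -- applied on the event that the weight of `i` is in `S`, which has activation mass `t = ν i S`.
  refine lintegral_mono' (Measure.le_iff.2 fun S hS => ?_) le_rfl
  rw [Measure.smul_apply, smul_eq_mul, Measure.map_apply (hW i) hS,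
    Measure.restrict_apply (hW i hS)]
  rcases eq_or_ne (x i) 0 with h0 | h0
  · have : ν i S = 0 := measure_mono_null (Set.subset_univ _) (by rw [← hxν, h0]; rfl)
    rw [show Measure.map (fun w => w i) (μ.restrict {w | i ∈ O w}) S = 0 from this]
    simp
  have hfin : ν i S ≠ ∞ :=
    ne_top_of_le_ne_top (by rw [← hxν]; simp) (measure_mono (Set.subset_univ S))
  have hmi : Measurable fun w : E → ℝ≥0 => S.indicator (fun r => (q i r : ℝ≥0∞)) (w i) :=
    ((hq i).coe_nnreal_ennreal.indicator hS).comp (measurable_pi_apply i)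
  refine le_measure_inter_uniqueColor (χ.seedLaw.prod μ) hH ?_ (hW i hS) hfin (p := χ.p) (x := x)
    (fun v => ?_) (fun j hj v => ?_) (χ.sum_eq i h0) χ.load_le hc
  · refine fun j v v' hv => Set.disjoint_left.2 fun ω h1 h2 => hv ?_
    exact Option.some.inj (h1.1.1.symm.trans h2.1.1)
  · rw [Measure.prod_apply_symm ((hW i hS).inter (hH i v)), hνS i S hS,
      ← lintegral_mul_const _ hmi]
    refine lintegral_congr fun w => ?_
    by_cases hw : w i ∈ S
    · rw [Set.indicator_of_mem hw, mul_comm, ← χ.seedLaw_colored i v (hq1 i (w i))]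
      congr 1; ext s; simp [ContentionColoring.coloredEvent, hw]
    · rw [Set.indicator_of_notMem hw, zero_mul]
      convert measure_empty (μ := χ.seedLaw)
      ext s; simp [hw]
  · have hmj : Measurable fun w : E → ℝ≥0 => (q j (w j) : ℝ≥0∞) :=
      (hq j).coe_nnreal_ennreal.comp (measurable_pi_apply j)
    have hmij : Measurable fun w : E → ℝ≥0 =>
        S.indicator (fun r => (q i r : ℝ≥0∞)) (w i) * (q j (w j) : ℝ≥0∞) := hmi.mul hmj
    have hxj : (x j : ℝ≥0∞) = ∫⁻ w, (q j (w j) : ℝ≥0∞) ∂μ := by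
      rw [hxν, hνS j _ .univ]; simp
    -- Pairwise independence of the weights is used here: activity of `i` with weight in `S` and
    -- activity of `j` decouple.
    have hprod := ProbabilityTheory.lintegral_mul_eq_lintegral_mul_lintegral_of_indepFun''
      hmi.aemeasurable hmj.aemeasurable ((hindep i j hj.symm).comp
        (φ := S.indicator fun r => (q i r : ℝ≥0∞)) (ψ := fun r => (q j r : ℝ≥0∞))
        ((hq i).coe_nnreal_ennreal.indicator hS) (hq j).coe_nnreal_ennreal)
    rw [Measure.prod_apply_symm ((hW i hS).inter ((hH i v).inter (hH j v)))]
    refine le_of_eq ?_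
    calc _ = ∫⁻ w, S.indicator (fun r => (q i r : ℝ≥0∞)) (w i) * (q j (w j) : ℝ≥0∞) *
          (χ.p i v * χ.p j v) ∂μ := by
          refine lintegral_congr fun w => ?_
          by_cases hw : w i ∈ S
          · rw [Set.indicator_of_mem hw]
            trans (χ.p i v * q i (w i) : ℝ≥0∞) * (χ.p j v * q j (w j))
            · rw [← χ.seedLaw_colored_pair hj.symm v (hq1 i (w i)) (hq1 j (w j))]
              congr 1; ext s; simp [ContentionColoring.coloredEvent, hw]
            · ring
          · rw [Set.indicator_of_notMem hw, zero_mul, zero_mul]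
            convert measure_empty (μ := χ.seedLaw)
            ext s; simp [hw]
      _ = _ := by
          rw [lintegral_mul_const _ hmij, hprod, hνS i S hS, hxj]; ring

end Algorithm

/-! ### Fractional matchings -/

/-- Every point `x` of the matroid polytope is the vector of row sums of a fractional matching `y`
of the elements to a finite set `V` in which each member of `V` has load at most `L`, such that
the sets which can be matched to `V` within the support of `y` are independent. -/
def HasFractionalMatchings {E : Type*} [Fintype E] (M : Matroid E) (L : ℝ≥0) : Prop :=
  ∀ x : E → ℝ≥0, (fun i => (x i : ℝ)) ∈ matroidPolytope M →
    ∃ (V : Type) (_ : Fintype V) (y : E → V → ℝ≥0), (∀ i, ∑ v, y i v = x i) ∧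
      (∀ v, ∑ i, y i v ≤ L) ∧
      ∀ (I : Set E) (f : E → V), Set.InjOn f I → (∀ i ∈ I, y i (f i) ≠ 0) → M.Indep I

theorem toNat_eRk_le {E : Type*} {M : Matroid E} (hM : M.E = Set.univ) {S : Set E} {k : ℕ}
    (h : ∀ I, I ⊆ S → M.Indep I → I.ncard ≤ k) : (M.eRk S).toNat ≤ k := by
  obtain ⟨I, hI⟩ := M.exists_isBasis S (by simp [hM])
  rw [← hI.encard_eq_eRk]
  exact h I hI.subset hI.indep

/-- The form in which all three classes use the polytope: a combinatorial bound on independent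
subsets of `S` bounds the mass of `S`. -/
theorem sum_le_of_mem_matroidPolytope {E : Type*} {M : Matroid E} (hM : M.E = Set.univ) {x : E → ℝ≥0}
    (hx : (fun i => (x i : ℝ)) ∈ matroidPolytope M) {S : Finset E} {k : ℕ}
    (h : ∀ I : Set E, I ⊆ S → M.Indep I → I.ncard ≤ k) : ∑ i ∈ S, x i ≤ k := by
  have h1 : ((∑ i ∈ S, x i : ℝ≥0) : ℝ) ≤ (M.eRk (S : Set E)).toNat := by
    rw [NNReal.coe_sum]; exact hx.2 S
  have h2 : ((M.eRk (S : Set E)).toNat : ℝ) ≤ k := by exact_mod_cast toNat_eRk_le hM h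
  exact_mod_cast h1.trans h2

section

variable {E : Type*} [Fintype E] {M : Matroid E}

/-- Choosing `v` with probability proportional to `y i v` makes `x j * p j v` at most `b * y j v`,
so column loads become colour loads. Where `x i = 0`, division by zero leaves `i` uncoloured. -/
theorem HasFractionalMatchings.hasContentionColorings {L : ℝ≥0} (h : HasFractionalMatchings M L)
    {b : ℝ≥0} (hb : b ≤ 1) : HasContentionColorings M b (b * L) := by
  intro x hx
  obtain ⟨V, _, y, hrow, hcol, hind⟩ := h x hx
  have hsum : ∀ i, x i ≠ 0 → ∑ v, b * (y i v / x i) = b := fun i hi => by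
    rw [← Finset.mul_sum, ← Finset.sum_div, hrow, div_self hi, mul_one]
  refine ⟨⟨V, fun i v => b * (y i v / x i), fun i => ?_, hsum, fun v => ?_,
    fun I f hf hp => hind I f hf fun i hi h0 => hp i hi (by simp [h0])⟩⟩
  · rcases eq_or_ne (x i) 0 with hi | hi
    · simp [hi]
    · exact (hsum i hi).trans_le hb
  · calc ∑ j, x j * (b * (y j v / x j)) ≤ ∑ j, b * y j v := Finset.sum_le_sum fun j _ => by
          rcases eq_or_ne (x j) 0 with hj | hj
          · simp [hj]
          · rw [mul_left_comm, mul_div_cancel₀ _ hj]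
      _ = b * ∑ j, y j v := by rw [Finset.mul_sum]
      _ ≤ b * L := by gcongr; exact hcol v

theorem HasFractionalMatchings.hasSelectablePIOCRS {L : ℝ≥0} (h : HasFractionalMatchings M L)
    {b c : ℝ≥0} (hb : b ≤ 1) (hc : c + b * (b * L) ≤ b) : HasSelectablePIOCRS M c :=
  hasSelectablePIOCRS_of_colorings (h.hasContentionColorings hb) hc

theorem HasFractionalMatchings.hasAlmightyProphetInequality {L : ℝ≥0}
    (h : HasFractionalMatchings M L) {b c : ℝ≥0} (hb : b ≤ 1) (hc : c + b * (b * L) ≤ b) :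
    HasAlmightyProphetInequality M c :=
  hasAlmightyProphetInequality_of_colorings (h.hasContentionColorings hb) hc

open Classical in
/-- A partition of the elements into groups of load at most `L` whose transversals are independent
is a fractional matching. -/
theorem exists_fractionalMatching_of_groups {W : Type*} [Finite W] {x : E → ℝ≥0} {L : ℝ≥0}
    (g : E → W) (hload : ∀ w, ∑ i with g i = w, x i ≤ L)
    (hind : ∀ I : Set E, Set.InjOn g I → (∀ i ∈ I, x i ≠ 0) → M.Indep I) :
    ∃ (V : Type) (_ : Fintype V) (y : E → V → ℝ≥0), (∀ i, ∑ v, y i v = x i) ∧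
      (∀ v, ∑ i, y i v ≤ L) ∧
      ∀ (I : Set E) (f : E → V), Set.InjOn f I → (∀ i ∈ I, y i (f i) ≠ 0) → M.Indep I := by
  obtain ⟨n, ⟨e⟩⟩ := Finite.exists_equiv_fin W
  refine ⟨Fin n, inferInstance, fun i v => if e (g i) = v then x i else 0, fun i => by simp,
    fun v => ?_, fun I f hf hp => hind I ?_ fun i hi => ?_⟩
  · rw [← Finset.sum_filter]
    simpa only [← Equiv.eq_symm_apply] using hload (e.symm v)
  · have hfg : ∀ i ∈ I, e (g i) = f i := fun i hi => by
      by_contra h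
      exact hp i hi (if_neg h)
    exact fun i hi j hj hij => hf hi hj (by rw [← hfg i hi, ← hfg j hj, hij])
  · exact fun h0 => hp i hi (by simp [h0])

end

/-! ### Laminar matroids -/

section Laminar

variable {E : Type*} [Fintype E]

/-- All values other than a smallest one `u` are at least `d`, and `u` together with one further
value accounts for `2 * d`. -/
theorem card_le_sum_of_pairwise {W : Type*} {U : Finset W} {l : W → ℝ≥0} {d : ℝ≥0}
    (hU : 1 < U.card) (h : ∀ u ∈ U, ∀ v ∈ U, u ≠ v → 2 * d ≤ l u + l v) :
    U.card * d ≤ ∑ u ∈ U, l u := by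
  classical
  obtain ⟨u, hu, hmin⟩ := Finset.exists_min_image U l (Finset.card_pos.1 (by omega))
  obtain ⟨v, hv, hvu⟩ := Finset.exists_mem_ne hU u
  have hge : ∀ w ∈ U, w ≠ u → d ≤ l w := fun w hw hwu => by
    have h1 := h u hu w hw hwu.symm
    have h2 := hmin w hw
    by_contra! h3
    have : l u + l w < 2 * d := by rw [two_mul]; exact add_lt_add (h2.trans_lt h3) h3
    exact absurd h1 this.not_ge
  have hrest : ((U.erase u).erase v).card • d ≤ ∑ w ∈ (U.erase u).erase v, l w :=
    Finset.card_nsmul_le_sum _ _ _ fun w hw => by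
      simp only [Finset.mem_erase] at hw
      exact hge w hw.2.2 hw.2.1
  have hvU : v ∈ U.erase u := Finset.mem_erase.2 ⟨hvu, hv⟩
  rw [← Finset.add_sum_erase U l hu, ← Finset.add_sum_erase _ l hvU, ← add_assoc]
  have hcard : U.card = ((U.erase u).erase v).card + 2 := by
    rw [Finset.card_erase_of_mem hvU, Finset.card_erase_of_mem hu]; omega
  calc (U.card : ℝ≥0) * d = 2 * d + ((U.erase u).erase v).card • d := by
        rw [hcard, nsmul_eq_mul]; push_cast; ring
    _ ≤ _ := add_le_add (h u hu v hv hvu.symm) hrest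

open Classical in
/-- Merging groups within the members of a laminar family, from the smallest to the largest, gives
groups of load at most `2` such that each member `S` meets few groups. -/
theorem exists_groups_of_laminar (x : E → ℝ≥0) (hx : ∀ i, x i ≤ 2) (A : Finset (Set E))
    (hA : ∀ S ∈ A, ∀ T ∈ A, S ⊆ T ∨ T ⊆ S ∨ Disjoint S T) :
    ∃ g : E → E, (∀ w, ∑ i with g i = w, x i ≤ 2) ∧
      (∀ i j, i ≠ j → g i = g j → ∃ S ∈ A, i ∈ S ∧ j ∈ S) ∧
      ∀ S ∈ A, (g '' S).ncard ≤ 1 ∨ ((g '' S).ncard : ℝ≥0) ≤ ∑ i with i ∈ S, x i := by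
  induction A using Finset.induction_on_max_value (fun S : Set E => S.ncard) with
  | empty =>
    refine ⟨id, fun w => ?_, fun i j hij h => absurd h hij, by simp⟩
    have : (Finset.univ.filter fun i => id i = w) = {w} := by ext; simp
    rw [this, Finset.sum_singleton]
    exact hx w
  | insert T A hT hmax ih =>
    obtain ⟨g, hload, hloc, hcount⟩ := ih fun S hS S' hS' =>
      hA S (Finset.mem_insert_of_mem hS) S' (Finset.mem_insert_of_mem hS')
    -- `T` has the largest cardinality, so a member containing it equals it.
    have hsub : ∀ S ∈ A, S ⊆ T ∨ Disjoint S T := fun S hS => by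
      rcases hA S (Finset.mem_insert_of_mem hS) T (Finset.mem_insert_self _ _) with h | h | h
      · exact Or.inl h
      · exact Or.inl (Set.eq_of_subset_of_ncard_le h (hmax S hS)).ge
      · exact Or.inr h
    -- Among the coarsenings of `g` with small loads and local groups, one is taken that meets `T`
    -- in the fewest groups. Two groups meeting `T` with total load below 2 could be merged, so
    -- every such pair has load at least 2 and the groups average at least 1.
    let P : (E → E) → Prop := fun f => (∀ w, ∑ i with f i = w, x i ≤ 2) ∧
      (∀ i j, i ≠ j → f i = f j → ∃ S ∈ insert T A, i ∈ S ∧ j ∈ S) ∧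
      ∀ i j, g i = g j → f i = f j
    have hPg : P g := ⟨hload, fun i j hij h => by
      obtain ⟨S, hS, h⟩ := hloc i j hij h
      exact ⟨S, Finset.mem_insert_of_mem hS, h⟩, fun _ _ h => h⟩
    obtain ⟨f, ⟨hfl, hfloc, hfg⟩, hmin⟩ := Set.exists_min_image {f | P f}
      (fun f => (f '' T).ncard) (Set.toFinite _) ⟨g, hPg⟩
    -- A group meeting `T` lies inside `T`, so the loads of these groups add up to the mass of `T`.
    have hclosed : ∀ i j, i ∈ T → f j = f i → j ∈ T := fun i j hi hij => by
      rcases eq_or_ne j i with rfl | hne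
      · exact hi
      obtain ⟨S, hS, hjS, hiS⟩ := hfloc j i hne hij
      rcases Finset.mem_insert.1 hS with rfl | hS
      · exact hjS
      rcases hsub S hS with h | h
      · exact h hjS
      · exact absurd hi (Set.disjoint_left.1 h hiS)
    refine ⟨f, hfl, hfloc, fun S hS => ?_⟩
    rcases Finset.mem_insert.1 hS with rfl | hS
    · by_cases h1 : (f '' S).ncard ≤ 1
      · exact Or.inl h1
      right
      have hcard : (f '' S).ncard = (f '' S).toFinset.card := Set.ncard_eq_toFinset_card' _
      have hpair : ∀ u ∈ (f '' S).toFinset, ∀ v ∈ (f '' S).toFinset, u ≠ v →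
          2 * 1 ≤ (∑ i with f i = u, x i) + ∑ i with f i = v, x i := by
        intro u hu v hv huv
        rw [Set.mem_toFinset] at hu hv
        by_contra! hlt
        have hP : P fun i => if f i = u then v else f i := by
          refine ⟨fun w => ?_, fun i j hij h => ?_, fun i j h => by simp only [hfg i j h]⟩
          · rcases eq_or_ne w v with rfl | hwv
            · refine le_trans ?_ (hlt.le.trans (by norm_num))
              rw [← Finset.sum_union]
              · refine Finset.sum_le_sum_of_subset fun i => ?_
                simp only [Finset.mem_filter, Finset.mem_univ, true_and, Finset.mem_union]
                split_ifs with h <;> tauto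
              · refine Finset.disjoint_left.2 fun i hi hi' => huv ?_
                simp only [Finset.mem_filter, Finset.mem_univ, true_and] at hi hi'
                exact hi.symm.trans hi'
            · refine le_trans (Finset.sum_le_sum_of_subset fun i => ?_) (hfl w)
              simp only [Finset.mem_filter, Finset.mem_univ, true_and]
              split_ifs with h
              · intro h'; exact absurd h'.symm hwv
              · exact id
          · by_cases hf : f i = f j
            · exact hfloc i j hij hf
            have huT : ∀ k, f k = u ∨ f k = v → k ∈ S := by
              obtain ⟨a, ha, hau⟩ := hu
              obtain ⟨c, hc, hcv⟩ := hv
              rintro k (hk | hk)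
              · exact hclosed a k ha (hk.trans hau.symm)
              · exact hclosed c k hc (hk.trans hcv.symm)
            refine ⟨S, Finset.mem_insert_self _ _, huT i ?_, huT j ?_⟩
            all_goals
              simp only at h
              split_ifs at h with h1 h2 h2
              · exact absurd (h1.trans h2.symm) hf
              all_goals simp_all
        refine absurd (hmin _ hP) (not_le.2 ?_)
        have hss : (fun i => if f i = u then v else f i) '' S ⊆ (f '' S) \ {u} := by
          rintro _ ⟨i, hi, rfl⟩
          simp only
          split_ifs with h
          · exact ⟨hv, huv.symm⟩
          · exact ⟨⟨i, hi, rfl⟩, h⟩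
        exact (Set.ncard_le_ncard hss).trans_lt (Set.ncard_sdiff_singleton_lt_of_mem hu)
      have := card_le_sum_of_pairwise (by rw [← hcard]; omega) hpair
      rw [mul_one, ← hcard] at this
      refine this.trans ?_
      rw [← Finset.sum_fiberwise_of_maps_to (s := Finset.univ.filter fun i => i ∈ S)
        (t := (f '' S).toFinset) (g := f) (by
          intro i hi
          rw [Set.mem_toFinset]
          exact ⟨i, (Finset.mem_filter.1 hi).2, rfl⟩)]
      refine Finset.sum_le_sum fun u hu => Finset.sum_le_sum_of_subset fun i hi => ?_
      rw [Set.mem_toFinset] at hu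
      obtain ⟨a, ha, rfl⟩ := hu
      simp only [Finset.mem_filter, Finset.mem_univ, true_and] at hi ⊢
      exact ⟨hclosed a i ha hi, hi⟩
    -- Coarsening cannot increase the number of groups meeting an earlier member.
    · have hle : (f '' S).ncard ≤ (g '' S).ncard := by
        have : f '' S ⊆ (fun w => if h : ∃ i, g i = w then f h.choose else w) '' (g '' S) := by
          rintro _ ⟨i, hi, rfl⟩
          refine ⟨g i, ⟨i, hi, rfl⟩, ?_⟩
          have hex : ∃ j, g j = g i := ⟨i, rfl⟩
          simp only [hex, dite_true]
          exact hfg _ _ hex.choose_spec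
        exact (Set.ncard_le_ncard this).trans (Set.ncard_image_le (Set.toFinite _))
      rcases hcount S hS with h | h
      · exact Or.inl (hle.trans h)
      · exact Or.inr (le_trans (by exact_mod_cast hle) h)

/-- A transversal of the groups meets `S` at most as often as groups do, hence at most `x(S) ≤ c S`
times. If only one group meets `S`, the bound 1 suffices, since capacity 0 would force `x = 0` on
`S`. -/
theorem IsLaminar.hasFractionalMatchings {M : Matroid E} (hM : M.E = Set.univ) (h : IsLaminar M) :
    HasFractionalMatchings M 2 := by
  classical
  obtain ⟨A, c, hA, hind⟩ := h
  intro x hx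
  have hx1 : ∀ i, x i ≤ 1 := fun i => by
    have := sum_le_of_mem_matroidPolytope hM hx (S := {i}) (k := 1) fun I hI _ => by
      rw [Finset.coe_singleton] at hI
      simpa using Set.ncard_le_ncard hI
    simpa using this
  have hxS : ∀ S ∈ A, ∑ i with i ∈ S, x i ≤ c S := fun S hS =>
    sum_le_of_mem_matroidPolytope hM hx fun I hI hIM => by
      have := ((hind I).1 hIM).2 S hS
      rwa [Set.inter_eq_left.2 (by simpa [Set.subset_def] using hI)] at this
  obtain ⟨g, hload, -, hcount⟩ := exists_groups_of_laminar x (fun i => (hx1 i).trans (by norm_num))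
    (Set.toFinite A).toFinset (by simpa using hA)
  refine exists_fractionalMatching_of_groups g hload fun I hI hpos => (hind I).2
    ⟨by simp [hM], fun S hS => ?_⟩
  have hle : (I ∩ S).ncard ≤ (g '' S).ncard := by
    rw [← (hI.mono Set.inter_subset_left).ncard_image]
    exact Set.ncard_le_ncard (Set.image_mono Set.inter_subset_right)
  rcases (I ∩ S).eq_empty_or_nonempty with he | ⟨i, hiI, hiS⟩
  · simp [he]
  rcases hcount S (by simpa using hS) with h | h
  · refine (hle.trans h).trans (Nat.one_le_iff_ne_zero.2 fun h0 => hpos i hiI ?_)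
    have := hxS S hS
    rw [h0, Nat.cast_zero, nonpos_iff_eq_zero, Finset.sum_eq_zero_iff] at this
    exact this i (by simpa using hiS)
  · exact hle.trans (by exact_mod_cast h.trans (hxS S hS))

end Laminar

/-! ### Graphic matroids -/

section Graphic

variable {V E : Type*} {G : Graph V E}

theorem containsCycle_of_isLink_self {F : Set E} {e : E} {v : V} (he : e ∈ F)
    (hv : G.IsLink e v v) : ContainsCycle G F :=
  have : Subsingleton (Fin (0 + 1)) := inferInstanceAs (Subsingleton (Fin 1))
  ⟨0, fun _ => v, fun _ => e, Function.injective_of_subsingleton _,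
    Function.injective_of_subsingleton _, fun _ => he, fun _ => hv⟩

/-- If each end of each edge in `F` is an end of a further edge in `F`, or of a loop in `F`, then
`F` contains a cycle. -/
theorem containsCycle_of_forall_exists [Finite V] {F : Set E} (hF : F.Nonempty)
    (hFG : F ⊆ G.edgeSet)
    (h : ∀ e ∈ F, ∀ v, G.Inc e v → ∃ e' ∈ F, G.Inc e' v ∧ (e' ≠ e ∨ G.IsLink e v v)) :
    ContainsCycle G F := by
  classical
  by_cases hloop : ∃ e ∈ F, ∃ v, G.IsLink e v v
  · obtain ⟨e, he, v, hv⟩ := hloop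
    exact containsCycle_of_isLink_self he hv
  push Not at hloop
  -- Directed edges of `F`: following `next` gives an infinite walk that never reuses the edge just
  -- traversed. Its first return to an earlier vertex closes a cycle.
  let D := {d : V × E × V // d.2.1 ∈ F ∧ G.IsLink d.2.1 d.1 d.2.2}
  have hnext : ∀ d : D, ∃ d' : D, d'.1.1 = d.1.2.2 ∧ d'.1.2.1 ≠ d.1.2.1 := by
    rintro ⟨⟨u, e, w⟩, he, hl⟩
    obtain ⟨e', he', hinc, hne⟩ := h e he w hl.inc_right
    obtain ⟨z, hz⟩ := hinc
    exact ⟨⟨⟨w, e', z⟩, he', hz⟩, rfl, hne.resolve_right (hloop e he w)⟩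
  choose next hnext1 hnext2 using hnext
  obtain ⟨e₀, he₀⟩ := hF
  obtain ⟨a₀, c₀, hl₀⟩ := Graph.exists_isLink_of_mem_edgeSet (hFG he₀)
  let d : ℕ → D := fun k => next^[k] ⟨⟨a₀, e₀, c₀⟩, he₀, hl₀⟩
  have hd : ∀ k, d (k + 1) = next (d k) := fun k => Function.iterate_succ_apply' _ _ _
  let v : ℕ → V := fun k => (d k).1.1
  let e : ℕ → E := fun k => (d k).1.2.1
  have hv : ∀ k, G.IsLink (e k) (v k) (v (k + 1)) := fun k => by
    have : v (k + 1) = (d k).1.2.2 := by simp only [v, hd]; exact hnext1 _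
    rw [this]; exact (d k).2.2
  have he : ∀ k, e (k + 1) ≠ e k := fun k => by simp only [e, hd]; exact hnext2 _
  have heF : ∀ k, e k ∈ F := fun k => (d k).2.1
  have hrep : ∃ b, ∃ a < b, v a = v b := by
    obtain ⟨a, b, hab, h⟩ := Finite.exists_ne_map_eq_of_infinite v
    rcases lt_or_gt_of_ne hab with hlt | hlt
    · exact ⟨b, a, hlt, h⟩
    · exact ⟨a, b, hlt, h.symm⟩
  obtain ⟨a, hab, hvab⟩ := Nat.find_spec hrep
  set b := Nat.find hrep with hb
  have hinj : ∀ k l, k < b → l < b → v k = v l → k = l := fun k l hk hl hkl => by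
    by_contra hne
    rcases lt_or_gt_of_ne hne with hlt | hlt
    · exact Nat.find_min hrep hl ⟨k, hlt, hkl⟩
    · exact Nat.find_min hrep hk ⟨l, hlt, hkl.symm⟩
  -- Equal edges have equal ends: traversed in the same direction they repeat a vertex too early, in
  -- the opposite direction they force `l = k + 1`, an immediate backtrack.
  have heinj : ∀ k l, a ≤ k → k < l → l < b → e k ≠ e l := fun k l hak hkl hlb heq => by
    have hl := hv l
    rw [← heq] at hl
    rcases (hv k).eq_and_eq_or_eq_and_eq hl with ⟨h1, -⟩ | ⟨-, h2⟩
    · exact hkl.ne (hinj k l (hkl.trans hlb) hlb h1)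
    · have := hinj (k + 1) l (by omega) hlb h2
      subst this
      exact he k heq.symm
  obtain ⟨n, hn⟩ : ∃ n, b = a + n + 1 := ⟨b - a - 1, by omega⟩
  refine ⟨n, fun i => v (a + i), fun i => e (a + i), fun i j hij => ?_, fun i j hij => ?_,
    fun i => heF _, fun i => ?_⟩
  · have := hinj _ _ (by omega) (by omega) hij
    exact Fin.ext (by omega)
  · by_contra hne
    rcases lt_or_gt_of_ne (fun h => hne (Fin.ext h) : (i : ℕ) ≠ j) with hlt | hlt
    · exact heinj (a + i) (a + j) (by omega) (by omega) (by omega) hij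
    · exact heinj (a + j) (a + i) (by omega) (by omega) (by omega) hij.symm
  · have := hv (a + i)
    rcases eq_or_ne i (Fin.last n) with rfl | hi
    · simp only [Fin.last_add_one, Fin.val_zero, add_zero, hvab]
      simpa only [Fin.val_last, ← hn] using this
    · simp only [Fin.val_add_one_of_lt (Fin.lt_last_iff_ne_last.2 hi)]
      exact this

/-- A forest on the vertex set `S` has at most `|S|` edges. -/
theorem card_le_of_not_containsCycle [Finite V] (S : Finset V) (F : Finset E)
    (hFG : (F : Set E) ⊆ G.edgeSet) (hFS : ∀ e ∈ F, ∀ v, G.Inc e v → v ∈ S)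
    (hF : ¬ ContainsCycle G (F : Set E)) : F.card ≤ S.card := by
  classical
  induction F using Finset.strongInduction generalizing S with
  | H F ih =>
    rcases F.eq_empty_or_nonempty with rfl | hne
    · simp
    -- Without a leaf the walk argument would produce a cycle; a leaf edge and its end vertex are
    -- removed together.
    have hex : ∃ e ∈ F, ∃ v, G.Inc e v ∧ ∀ e' ∈ F, G.Inc e' v → e' = e := by
      by_contra! hcon
      refine hF (containsCycle_of_forall_exists hne hFG fun e he v hv => ?_)
      obtain ⟨e', he', hv', hne⟩ := hcon e he v hv
      exact ⟨e', he', hv', Or.inl hne⟩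
    obtain ⟨e, he, v, hev, huniq⟩ := hex
    have := ih (F.erase e) (Finset.erase_ssubset he) (S.erase v)
      (fun e' he' => hFG (Finset.mem_of_mem_erase he'))
      (fun e' he' u hu => Finset.mem_erase.2 ⟨?_, hFS e' (Finset.mem_of_mem_erase he') u hu⟩)
      (fun ⟨n, v, e, h1, h2, h3, h4⟩ => hF ⟨n, v, e, h1, h2,
        fun i => Finset.mem_of_mem_erase (h3 i), h4⟩)
    · rw [Finset.card_erase_of_mem he, Finset.card_erase_of_mem (hFS e he v hev)] at this
      have h1 := Finset.card_pos.2 ⟨e, he⟩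
      have h2 := Finset.card_pos.2 ⟨v, hFS e he v hev⟩
      omega
    · rintro rfl
      exact Finset.ne_of_mem_erase he' (huniq e' (Finset.mem_of_mem_erase he') hu)

open Classical in
theorem card_filter_inc_le_two (S : Finset V) (e : E) : (S.filter fun v => G.Inc e v).card ≤ 2 := by
  by_contra! h
  obtain ⟨a, b, c, ha, hb, hc, hab, hac, hbc⟩ := Finset.two_lt_card_iff.1 h
  simp only [Finset.mem_filter] at ha hb hc
  rcases Graph.Inc.eq_or_eq_or_eq ha.2 hb.2 hc.2 with h | h | h <;> contradiction

open Classical in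
/-- If the edges within any set `S` of vertices have load at most `|S|`, then the edges can be
assigned to ends of theirs so that each vertex has load at most `2` and edges assigned to distinct
vertices form a forest. -/
theorem exists_assignment_of_sum_le [Fintype E] (x : E → ℝ≥0)
    (hx : ∀ S : Finset V, ∑ e with ∀ v, G.Inc e v → v ∈ S, x e ≤ S.card) [Nonempty V]
    (S : Finset V) :
    ∃ g : E → V, (∀ e ∈ G.edgeSet, (∀ u, G.Inc e u → u ∈ S) → G.Inc e (g e)) ∧
      (∀ v, ∑ e with (∀ u, G.Inc e u → u ∈ S) ∧ e ∈ G.edgeSet ∧ g e = v, x e ≤ 2) ∧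
      ∀ I : Set E, (∀ e ∈ I, ∀ u, G.Inc e u → u ∈ S) → (∀ e ∈ I, ∀ v, ¬ G.IsLink e v v) →
        Set.InjOn g I → ¬ ContainsCycle G I := by
  induction S using Finset.strongInduction with
  | H S ih =>
    rcases S.eq_empty_or_nonempty with rfl | hS
    · refine ⟨fun _ => Classical.arbitrary V, fun e he h => ?_, fun v => ?_, fun I hI _ _ hC => ?_⟩
      · obtain ⟨u, w, hl⟩ := Graph.exists_isLink_of_mem_edgeSet he
        exact absurd (h u hl.inc_left) (by simp)
      · rw [Finset.sum_eq_zero]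
        · exact zero_le
        · intro e he
          simp only [Finset.mem_filter, Finset.mem_univ, true_and] at he
          obtain ⟨u, w, hl⟩ := Graph.exists_isLink_of_mem_edgeSet he.2.1
          exact absurd (he.1 u hl.inc_left) (by simp)
      · obtain ⟨n, v, e, -, -, he, hl⟩ := hC
        exact absurd (hI _ (he 0) _ (hl 0).inc_left) (by simp)
    -- Each edge inside `S` is counted at no more than two vertices, so the fractional degrees sum
    -- to at most `2 * |S|` and some vertex has degree at most 2. That vertex takes all its edges
    -- inside `S`.
    have hdeg : ∃ v ∈ S, ∑ e with (∀ u, G.Inc e u → u ∈ S) ∧ G.Inc e v, x e ≤ 2 := by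
      by_contra! hcon
      have h1 : S.card • (2 : ℝ≥0) <
          ∑ v ∈ S, ∑ e with (∀ u, G.Inc e u → u ∈ S) ∧ G.Inc e v, x e := by
        rw [← Finset.sum_const]
        exact Finset.sum_lt_sum_of_nonempty hS hcon
      have h2 : ∑ v ∈ S, ∑ e with (∀ u, G.Inc e u → u ∈ S) ∧ G.Inc e v, x e ≤
          ∑ e with (∀ u, G.Inc e u → u ∈ S), 2 * x e := by
        simp only [← Finset.filter_filter]
        simp_rw [Finset.sum_filter (fun e => G.Inc e _)]
        rw [Finset.sum_comm]
        refine Finset.sum_le_sum fun e _ => ?_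
        rw [← Finset.sum_filter, Finset.sum_const, nsmul_eq_mul]
        gcongr
        exact_mod_cast card_filter_inc_le_two S e
      rw [← Finset.mul_sum] at h2
      have h3 := h1.trans_le (h2.trans (mul_le_mul_right (hx S) 2))
      rw [nsmul_eq_mul, mul_comm] at h3
      exact lt_irrefl _ h3
    obtain ⟨v, hvS, hv⟩ := hdeg
    obtain ⟨g, hend, hload, hforest⟩ := ih (S.erase v) (Finset.erase_ssubset hvS)
    have herase : ∀ e, (∀ u, G.Inc e u → u ∈ S) → ¬ G.Inc e v →
        ∀ u, G.Inc e u → u ∈ S.erase v := fun e heS hev u hu =>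
      Finset.mem_erase.2 ⟨fun h => hev (h ▸ hu), heS u hu⟩
    refine ⟨fun e => if G.Inc e v then v else g e, fun e he heS => ?_, fun w => ?_,
      fun I hI hloop hinj hC => ?_⟩
    · by_cases hev : G.Inc e v
      · simp [hev]
      · simpa [hev] using hend e he (herase e heS hev)
    · rcases eq_or_ne w v with rfl | hwv
      · refine (Finset.sum_le_sum_of_subset fun e he => ?_).trans hv
        simp only [Finset.mem_filter, Finset.mem_univ, true_and] at he ⊢
        refine ⟨he.1, by_contra fun hev => hev ?_⟩
        have h := he.2.2
        rw [if_neg hev] at h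
        have := hend e he.2.1 (herase e he.1 hev)
        rwa [h] at this
      · refine (Finset.sum_le_sum_of_subset fun e he => ?_).trans (hload w)
        simp only [Finset.mem_filter, Finset.mem_univ, true_and] at he ⊢
        obtain ⟨heS, heG, h⟩ := he
        split_ifs at h with hev
        · exact absurd h.symm hwv
        · exact ⟨herase e heS hev, heG, h⟩
    · obtain ⟨n, u, e, hu, he, heI, hl⟩ := hC
      -- If the cycle passes through `v`, its edges `e (j - 1)` and `e j` are both assigned to `v`,
      -- hence equal, which forces a loop. Otherwise it survives in `S.erase v`.
      by_cases hj : ∃ j, u j = v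
      · obtain ⟨j, rfl⟩ := hj
        have hl' := hl (j - 1)
        rw [sub_add_cancel] at hl'
        have hee : e (j - 1) = e j := hinj (heI _) (heI _) <| by
          simp only [hl'.inc_right, (hl j).inc_left, if_true]
        have hjj := he hee
        rw [hee, hjj] at hl'
        exact hloop _ (heI j) _ hl'
      · push Not at hj
        have hev : ∀ i, ¬ G.Inc (e i) v := fun i hi => by
          rcases hi.eq_or_eq_of_isLink (hl i) with h | h
          · exact hj _ h.symm
          · exact hj _ h.symm
        refine hforest {e | e ∈ I ∧ ¬ G.Inc e v} (fun e he => herase e (hI e he.1) he.2)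
          (fun e he => hloop e he.1) (fun e he e' he' h => hinj he.1 he'.1 ?_)
          ⟨n, u, e, hu, he, fun i => ⟨heI i, hev i⟩, hl⟩
        simp only [if_neg he.2, if_neg he'.2]
        exact h

/-- Forests inside a vertex set `S` have at most `|S|` edges, which supplies the mass bound for the
assignment. Loops have rank 0, hence mass 0, and drop out of the support. -/
theorem IsGraphic.hasFractionalMatchings [Fintype E] {M : Matroid E} (hM : M.E = Set.univ)
    (h : IsGraphic M) : HasFractionalMatchings M 2 := by
  classical
  obtain ⟨V, hV, G, hE, hind⟩ := h
  have hG : G.edgeSet = Set.univ := hE.symm.trans hM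
  have := Fintype.ofFinite V
  intro x hx
  rcases isEmpty_or_nonempty V with hVe | hVe
  · have hEe : ∀ e : E, False := fun e => by
      obtain ⟨u, -⟩ := Graph.exists_isLink_of_mem_edgeSet (G := G) (e := e) (by simp [hG])
      exact hVe.false u
    refine ⟨V, this, fun e => (hEe e).elim, fun e => (hEe e).elim, fun v => (hVe.false v).elim,
      fun I _ _ _ => ?_⟩
    have hI : I = ∅ := Set.eq_empty_of_forall_notMem fun e _ => hEe e
    rw [hI]
    exact M.empty_indep
  have hloop : ∀ e v, G.IsLink e v v → x e = 0 := fun e v hl => by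
    have := sum_le_of_mem_matroidPolytope hM hx (S := {e}) (k := 0) fun I hI hIM => by
      rw [nonpos_iff_eq_zero, Set.ncard_eq_zero]
      refine Set.eq_empty_of_forall_notMem fun e' he' => ((hind I).1 hIM).2 ?_
      obtain rfl : e' = e := by simpa using hI he'
      exact containsCycle_of_isLink_self he' hl
    simpa using this
  obtain ⟨g, hg⟩ := exists_assignment_of_sum_le (G := G) x (fun S =>
    sum_le_of_mem_matroidPolytope hM hx fun I hI hIM => by
      rw [Set.ncard_eq_toFinset_card']
      refine card_le_of_not_containsCycle (G := G) S _ (by simp [hG]) (fun e he => ?_) ?_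
      · simpa using hI (Set.mem_toFinset.1 he)
      · rw [Set.coe_toFinset]
        exact ((hind I).1 hIM).2) Finset.univ
  refine exists_fractionalMatching_of_groups g (fun v => ?_) fun I hI hpos => ?_
  · refine (Finset.sum_le_sum_of_subset fun e he => ?_).trans (hg.2.1 v)
    simpa [hG] using he
  · refine (hind I).2 ⟨by simp [hG], hg.2.2 I (by simp) (fun e he v hl => ?_) hI⟩
    exact hpos e he (hloop e v hl)

end Graphic

/-! ### Transversal matroids -/

section Transversal

variable {E V : Type*} [Fintype E] [Fintype V]

open Classical in
/-- Up to rounding `K • x` down, a vector satisfying Hall's condition has a fractional matching. -/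
theorem exists_fractionalMatching_floor (N : E → V → Prop) (x : E → ℝ≥0)
    (hall : ∀ S : Finset E, ∑ i ∈ S, x i ≤ (Finset.univ.filter fun v => ∃ i ∈ S, N i v).card)
    (K : ℕ) (hK : 0 < K) :
    ∃ y : E → V → ℝ≥0, (∀ i v, y i v ≠ 0 → N i v) ∧ (∀ v, ∑ i, y i v ≤ 1) ∧
      ∀ i, ∑ v, y i v = (⌊K * x i⌋₊ : ℝ≥0) / K := by
  have hK' : (K : ℝ≥0) ≠ 0 := by exact_mod_cast hK.ne'
  -- Hall's theorem is applied to `⌊K * x i⌋₊` copies of `i` and `K` copies of each vertex; dividing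
  -- by `K` turns the matching into a fractional one.
  let t : (Σ i : E, Fin ⌊K * x i⌋₊) → Finset (V × Fin K) := fun a =>
    (Finset.univ.filter fun v => N a.1 v) ×ˢ Finset.univ
  obtain ⟨f, hf, hft⟩ := (Finset.all_card_le_biUnion_card_iff_exists_injective t).1 fun s => by
    set S : Finset E := s.image Sigma.fst
    have h1 : s.card ≤ ∑ i ∈ S, ⌊K * x i⌋₊ := by
      have hs : s ⊆ S.sigma fun _ => Finset.univ := fun a ha => by
        exact Finset.mem_sigma.2 ⟨Finset.mem_image_of_mem Sigma.fst ha, Finset.mem_univ _⟩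
      simpa using Finset.card_le_card hs
    have h2 : s.biUnion t = (Finset.univ.filter fun v => ∃ i ∈ S, N i v) ×ˢ Finset.univ := by
      ext ⟨v, k⟩
      simp only [t, S, Finset.mem_biUnion, Finset.mem_product, Finset.mem_filter, Finset.mem_univ,
        true_and, and_true, Finset.mem_image]
      constructor
      · rintro ⟨a, ha, h⟩; exact ⟨a.1, ⟨a, ha, rfl⟩, h⟩
      · rintro ⟨_, ⟨a, ha, rfl⟩, h⟩; exact ⟨a, ha, h⟩
    rw [h2, Finset.card_product, Finset.card_univ, Fintype.card_fin]
    have h3 : ((∑ i ∈ S, ⌊K * x i⌋₊ : ℕ) : ℝ≥0) ≤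
        ((Finset.univ.filter fun v => ∃ i ∈ S, N i v).card * K : ℕ) := by
      push_cast
      calc ∑ i ∈ S, (⌊K * x i⌋₊ : ℝ≥0) ≤ ∑ i ∈ S, K * x i :=
            Finset.sum_le_sum fun i _ => Nat.floor_le zero_le
        _ = (∑ i ∈ S, x i) * K := by rw [← Finset.mul_sum, mul_comm]
        _ ≤ _ := by gcongr; exact hall S
    exact h1.trans (by exact_mod_cast h3)
  refine ⟨fun i v => ((Finset.univ.filter fun a => (f ⟨i, a⟩).1 = v).card : ℝ≥0) / K,
    fun i v h => ?_, fun v => ?_, fun i => ?_⟩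
  · have hne : (Finset.univ.filter fun a => (f ⟨i, a⟩).1 = v).Nonempty := by
      rw [← Finset.card_ne_zero]
      intro h0; simp [h0] at h
    obtain ⟨a, ha⟩ := hne
    have := hft ⟨i, a⟩
    simp only [t, Finset.mem_product, Finset.mem_filter, Finset.mem_univ, true_and, and_true]
      at this ha
    rwa [ha] at this
  · rw [← Finset.sum_div, div_le_one (by positivity)]
    have hcard : ∑ i, (Finset.univ.filter fun a => (f ⟨i, a⟩).1 = v).card ≤ K := by
      rw [← Finset.card_sigma]
      calc _ ≤ (({v} : Finset V) ×ˢ (Finset.univ : Finset (Fin K))).card :=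
            Finset.card_le_card_of_injOn f (fun a ha => Finset.mem_coe.2 <|
              Finset.mem_product.2 ⟨by simpa using ha, Finset.mem_univ _⟩) hf.injOn
        _ = K := by simp
    exact_mod_cast hcard
  · rw [← Finset.sum_div]
    congr 1
    have := Finset.card_eq_sum_card_fiberwise (f := fun a => (f ⟨i, a⟩).1)
      (s := (Finset.univ : Finset (Fin ⌊K * x i⌋₊))) (t := Finset.univ) (by simp)
    rw [Finset.card_univ, Fintype.card_fin] at this
    exact_mod_cast this.symm

open Classical in
/-- The fractional version of Hall's marriage theorem. -/
theorem exists_fractionalMatching (N : E → V → Prop) (x : E → ℝ≥0)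
    (hall : ∀ S : Finset E, ∑ i ∈ S, x i ≤ (Finset.univ.filter fun v => ∃ i ∈ S, N i v).card) :
    ∃ y : E → V → ℝ≥0, (∀ i v, y i v ≠ 0 → N i v) ∧ (∀ v, ∑ i, y i v ≤ 1) ∧
      ∀ i, ∑ v, y i v = x i := by
  -- The row equations are relaxed to inequalities, so that `C` is compact and contains all rounded
  -- matchings. A maximiser of the total mass beats each of them, losing at most `|E| / K` for every
  -- `K`, hence nothing.
  let C : Set (E → V → ℝ≥0) :=
    {y | (∀ i v, ¬ N i v → y i v = 0) ∧ (∀ v, ∑ i, y i v ≤ 1) ∧ ∀ i, ∑ v, y i v ≤ x i}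
  have hclosed : IsClosed C := by
    refine IsClosed.and ?_ (IsClosed.and ?_ ?_)
    · simp only [Set.ofPred_forall]
      exact isClosed_iInter fun i => isClosed_iInter fun v => isClosed_iInter fun _ =>
        isClosed_eq (by fun_prop) continuous_const
    · simp only [Set.ofPred_forall]
      exact isClosed_iInter fun v => isClosed_le (by fun_prop) continuous_const
    · simp only [Set.ofPred_forall]
      exact isClosed_iInter fun i => isClosed_le (by fun_prop) continuous_const
  have hcompact : IsCompact C := by
    refine (isCompact_univ_pi fun i => isCompact_univ_pi fun _ =>
      isCompact_Icc (a := 0) (b := x i)).of_isClosed_subset hclosed fun y hy i _ v _ =>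
        ⟨zero_le, (Finset.single_le_sum (f := y i) (fun _ _ => zero_le)
          (Finset.mem_univ v)).trans (hy.2.2 i)⟩
  have hfloor : ∀ K : ℕ, 0 < K → ∃ y ∈ C, ∀ i, ∑ v, y i v = (⌊K * x i⌋₊ : ℝ≥0) / K :=
    fun K hK => by
      obtain ⟨y, h1, h2, h3⟩ := exists_fractionalMatching_floor N x hall K hK
      refine ⟨y, ⟨fun i v h => by_contra fun h' => h (h1 i v h'), h2, fun i => ?_⟩, h3⟩
      rw [h3, div_le_iff₀ (by positivity), mul_comm]
      exact Nat.floor_le zero_le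
  obtain ⟨y, hyC, hmax⟩ := hcompact.exists_isMaxOn
    (let ⟨y, hy, _⟩ := hfloor 1 one_pos; ⟨y, hy⟩)
    (f := fun y => ∑ i, ∑ v, y i v) (by fun_prop)
  have hlim : ∑ i, x i ≤ ∑ i, ∑ v, y i v := by
    refine le_of_forall_pos_le_add fun ε hε => ?_
    obtain ⟨K, hK⟩ := exists_nat_gt ((Fintype.card E : ℝ≥0) / ε)
    have hK0 : (0 : ℝ≥0) < K := lt_of_le_of_lt zero_le hK
    obtain ⟨z, hz, hzs⟩ := hfloor K (by exact_mod_cast hK0)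
    have hKε : (Fintype.card E : ℝ≥0) / K ≤ ε := by
      rw [div_le_iff₀ hK0, mul_comm]
      exact ((div_lt_iff₀ hε).1 hK).le
    calc ∑ i, x i ≤ ∑ i, ((⌊K * x i⌋₊ : ℝ≥0) / K + 1 / K) := Finset.sum_le_sum fun i _ => by
          rw [← add_div, le_div_iff₀ hK0, mul_comm]
          exact (Nat.lt_floor_add_one _).le
      _ = ∑ i, ∑ v, z i v + (Fintype.card E : ℝ≥0) / K := by
          rw [Finset.sum_add_distrib]
          simp [hzs, div_eq_mul_inv]
      _ ≤ ∑ i, ∑ v, y i v + ε := add_le_add (hmax hz) hKε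
  refine ⟨y, fun i v h => by_contra fun h' => h (hyC.1 i v h'), hyC.2.1, ?_⟩
  -- Row sums bounded by `x i` with full total must be equal to `x i` one by one.
  have heq := le_antisymm (Finset.sum_le_sum fun i _ => hyC.2.2 i) hlim
  exact fun i => (Finset.sum_eq_sum_iff_of_le fun i _ => hyC.2.2 i).1 heq i (Finset.mem_univ i)

/-- An independent subset of `S` injects into the neighbourhood of `S`, so the rank inequalities
imply Hall's condition for `x`. -/
theorem IsTransversal.hasFractionalMatchings {M : Matroid E} (hM : M.E = Set.univ)
    (h : IsTransversal M) : HasFractionalMatchings M 1 := by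
  classical
  obtain ⟨V, hV, N, hind⟩ := h
  have := Fintype.ofFinite V
  intro x hx
  obtain ⟨y, hN, hcol, hrow⟩ := exists_fractionalMatching N x fun S =>
    sum_le_of_mem_matroidPolytope hM hx fun I hI hIM => by
      obtain ⟨-, f, hf, hfN⟩ := (hind I).1 hIM
      rw [← Nat.card_coe_set_eq, Nat.card_eq_fintype_card, ← Finset.card_univ]
      exact Finset.card_le_card_of_injOn f
        (fun i _ => by simpa using ⟨i.1, hI i.2, hfN i⟩) hf.injOn
  exact ⟨V, this, y, hrow, hcol, fun I f hf hp => (hind I).2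
    ⟨by simp [hM], fun i => f i, fun i j hij => Subtype.ext (hf i.2 j.2 hij),
      fun i => hN _ _ (hp i i.2)⟩⟩

end Transversal

end PIProphet

/-! ### The constants -/

theorem theorem1p2 {E : Type*} [Fintype E] (M : Matroid E) (hM : M.E = Set.univ) :
    (PIProphet.IsLaminar M →
      PIProphet.HasSelectablePIOCRS M (1 / 134) ∧
      PIProphet.HasAlmightyProphetInequality M (1 / 134)) ∧
    (PIProphet.IsGraphic M →
      PIProphet.HasSelectablePIOCRS M (1 / 8) ∧
      PIProphet.HasAlmightyProphetInequality M (1 / 8)) ∧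
    (PIProphet.IsTransversal M →
      PIProphet.HasSelectablePIOCRS M (1 / 4) ∧
      PIProphet.HasAlmightyProphetInequality M (1 / 4)) := by
  -- The guarantee `b - b * (b * L)` is largest at `b = 1 / (2 * L)`, with value `1 / (4 * L)`: `1 /
  -- 8` for `L = 2` and `1 / 4` for `L = 1`. The laminar case also has `L = 2`, so `1 / 134` holds
  -- with much room.
  have hquarter : (1 / 4 : ℝ≥0) ≤ 1 := by
    rw [← NNReal.coe_le_coe]; norm_num
  have hhalf : (1 / 2 : ℝ≥0) ≤ 1 := by
    rw [← NNReal.coe_le_coe]; norm_num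
  have h134 : (1 / 134 : ℝ≥0) + 1 / 4 * (1 / 4 * 2) ≤ 1 / 4 := by
    rw [← NNReal.coe_le_coe]; norm_num
  have h8 : (1 / 8 : ℝ≥0) + 1 / 4 * (1 / 4 * 2) ≤ 1 / 4 := by
    rw [← NNReal.coe_le_coe]; norm_num
  have h4 : (1 / 4 : ℝ≥0) + 1 / 2 * (1 / 2 * 1) ≤ 1 / 2 := by
    rw [← NNReal.coe_le_coe]; norm_num
  refine ⟨fun h => ?_, fun h => ?_, fun h => ?_⟩
  · have hy := h.hasFractionalMatchings hM
    exact ⟨by simpa using hy.hasSelectablePIOCRS hquarter h134,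
      by simpa using hy.hasAlmightyProphetInequality hquarter h134⟩
  · have hy := h.hasFractionalMatchings hM
    exact ⟨by simpa using hy.hasSelectablePIOCRS hquarter h8,
      by simpa using hy.hasAlmightyProphetInequality hquarter h8⟩
  · have hy := h.hasFractionalMatchings hM
    exact ⟨by simpa using hy.hasSelectablePIOCRS hhalf h4,
      by simpa using hy.hasAlmightyProphetInequality hhalf h4⟩
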